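/- **Setting.** Let $\Lambda\subset\mathbb R^d$ be compact. A *curve* in $\Lambda$ is a continuous map $f:[0,1]\to\Lambda$ up to reparametrization: $\mathcal S_\Lambda$ is the metric space obtained from the continuous maps $[0,1]\to\Lambda$ with $$\mathrm d(f_1,f_2)=\inf_{\phi_1,\phi_2}\ \sup_{t\in[0,1]}|f_1(\phi_1(t))-f_2(\phi_2(t))|$$ (infimum over continuous bijections $\phi_i$ of $[0,1]$ onto itself) by identifying maps at distance $0$. Let $\Omega_\Lambda$ be the space of closed subsets $\mathcal F$ of $\mathcal S_\Lambda$, with the topology of the Hausdorff distance and its Borel $\sigma$-algebra. A *system of random curves* in $\Lambda$ is a family $(\mu_\delta)_{0<\delta\le\delta_{\max}}$ of Borel probability measures on $\Omega_\Lambda$; $\mathcal F_\delta$ denotes the random configuration with law $\mu_\delta$. (In applications $\mathcal F_\delta$ consists of polygonal paths of step size $\delta$, but this is not required.) Probabilities of sets that are not measurable are understood as outer measures. A family of sets $A_1,\dots,A_k$ is *well separated* if the distance of each $A_j$ to the others is at least $\operatorname{diam}A_j$. A curve *traverses* a cylinder in the length direction if some segment of it stays in the (closed, solid) cylinder and joins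 its two end faces. The system satisfies **H2** if there are $\sigma>0$, $0\le\rho<1$ and $K<\infty$ such that, for every $\delta\in(0,\delta_{\max}]$, every $k$, and every well separated family of $k$ cylinders $A_1,\dots,A_k\subset\mathbb R^d$ of lengths $\ell_1,\dots,\ell_k\ge\delta$ and of cross-sectional diameters $\sigma\ell_1,\dots,\sigma\ell_k$, $$\mathrm{Prob}_\delta\big(\text{each }A_j\text{ is traversed in the length direction by a curve in }\mathcal F_\delta\big)\le K\rho^k .$$ For $s>0$, $\ell\ge0$ and $A\subset\mathbb R^d$, the capacity is defined by $$\frac1{\mathrm{Cap}_{s;\ell}(A)}=\inf_{\nu}\iint\frac{\nu(dx)\,\nu(dy)}{\max\{|x-y|,\ell\}^s},$$ the infimum being over the Borel probability measures $\nu$ on $\mathbb R^d$ that are supported on $A$. The diameter, capacity and Hausdorff dimension of a curve $\mathcal C$ are those of the set of points that it visits. A family of nonnegative (possibly infinite) random variables $X_\delta$ is *stochastically bounded away from zero* if for every $\varepsilon>0$ there is $u<\infty$ with $\mathrm{Prob}_\delta(X_\delta^{-1}\ge u)\le\varepsilon$ for all $\delta\in(0,\delta_{\max}]$. **Theorem (Roughness).**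 Let $(\mu_\delta)_{0<\delta\le\delta_{\max}}$ be a system of random curves in a compact set $\Lambda\subset\mathbb R^d$ that satisfies **H2**. Then there is $d_{\min}>1$ with the following properties. 1. For every $r>0$ and every $0<s<d_{\min}$, the random variable $$T_{s,r;\delta}=\inf_{\mathcal C\in\mathcal F_\delta:\ \operatorname{diam}\mathcal C\ge r}\mathrm{Cap}_{s;\delta}(\mathcal C)$$ (equal to $+\infty$ if there is no such curve) is stochastically bounded away from zero. 2. If $\delta_n\in(0,\delta_{\max}]$, $\delta_n\to0$, and $\mu_{\delta_n}$ converges weakly to a Borel probability measure $\mu$ on $\Omega_\Lambda$, then for $\mu$-almost every $\mathcal F$, every curve $\mathcal C\in\mathcal F$ that is not reduced to a point satisfies $\dim_{\mathcal H}\mathcal C\ge d_{\min}>1$; in particular it is not rectifiable. -/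

import Mathlib

open MeasureTheory Filter Topology TopologicalSpace
open scoped ENNReal NNReal

namespace RandomCurves

noncomputable section

/-- Euclidean space `ℝ^d`. -/
abbrev E (d : ℕ) : Type := EuclideanSpace ℝ (Fin d)

/-- The unit interval `[0, 1]`. -/
abbrev I : Type := unitInterval

/-! ### The space of curves -/

/-- Parametrized curves in `Λ`: continuous functions from the unit interval into `Λ`. -/
def ParamCurve {d : ℕ} (Λ : Set (E d)) : Type := C(I, Λ)

namespace ParamCurve

variable {d : ℕ} {Λ : Set (E d)}

/-- The position at time `t`, as a point of `ℝ^d`. -/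
def eval (f : ParamCurve Λ) (t : I) : E d := ((show C(I, Λ) from f) t : E d)

/-- Reparametrization by a continuous bijection of the unit interval onto itself.  Such
bijections are exactly the strictly monotone (increasing or decreasing) continuous ones. -/
def reparam (f : ParamCurve Λ) (φ : I ≃ₜ I) : C(I, Λ) :=
  (show C(I, Λ) from f).comp (φ : C(I, I))

/-- `d(f₁, f₂) = inf_{φ₁, φ₂} sup_t |f₁(φ₁(t)) - f₂(φ₂(t))|`, the infimum over all pairs of
reparametrizations (the distance in `C(I, Λ)` is the supremum distance). -/
def curveDist (f g : ParamCurve Λ) : ℝ :=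
  ⨅ p : (I ≃ₜ I) × (I ≃ₜ I), dist (f.reparam p.1) (g.reparam p.2)

theorem curveDist_bddBelow (f g : ParamCurve Λ) :
    BddBelow (Set.range fun p : (I ≃ₜ I) × (I ≃ₜ I) => dist (f.reparam p.1) (g.reparam p.2)) :=
  ⟨0, by rintro _ ⟨p, rfl⟩; exact dist_nonneg⟩

theorem curveDist_le (f g : ParamCurve Λ) (φ ψ : I ≃ₜ I) :
    curveDist f g ≤ dist (f.reparam φ) (g.reparam ψ) :=
  ciInf_le (curveDist_bddBelow f g) (φ, ψ)

theorem exists_reparam_lt {f g : ParamCurve Λ} {r : ℝ} (h : curveDist f g < r) :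
    ∃ φ ψ : I ≃ₜ I, dist (f.reparam φ) (g.reparam ψ) < r := by
  obtain ⟨p, hp⟩ := exists_lt_of_ciInf_lt h
  exact ⟨p.1, p.2, hp⟩

theorem dist_reparam_trans (f g : ParamCurve Λ) (φ ψ χ : I ≃ₜ I) :
    dist (f.reparam (χ.trans φ)) (g.reparam (χ.trans ψ)) ≤ dist (f.reparam φ) (g.reparam ψ) := by
  refine (ContinuousMap.dist_le dist_nonneg).2 fun t => ?_
  exact ContinuousMap.dist_apply_le_dist (f := f.reparam φ) (g := g.reparam ψ) (χ t)

theorem curveDist_triangle (f g h : ParamCurve Λ) :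
    curveDist f h ≤ curveDist f g + curveDist g h := by
  refine le_of_forall_pos_le_add fun ε hε => ?_
  obtain ⟨φ₁, φ₂, h₁⟩ := exists_reparam_lt (lt_add_of_pos_right (curveDist f g) (half_pos hε))
  obtain ⟨ψ₁, ψ₂, h₂⟩ := exists_reparam_lt (lt_add_of_pos_right (curveDist g h) (half_pos hε))
  have h₃ := dist_reparam_trans f g φ₁ φ₂ φ₂.symm
  have h₄ := dist_reparam_trans g h ψ₁ ψ₂ ψ₁.symm
  have e₁ : g.reparam (φ₂.symm.trans φ₂) = g.reparam (ψ₁.symm.trans ψ₁) := by simp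
  have h₅ := curveDist_le f h (φ₂.symm.trans φ₁) (ψ₁.symm.trans ψ₂)
  have h₆ := dist_triangle (f.reparam (φ₂.symm.trans φ₁)) (g.reparam (φ₂.symm.trans φ₂))
    (h.reparam (ψ₁.symm.trans ψ₂))
  rw [e₁] at h₃ h₆
  linarith

instance : PseudoMetricSpace (ParamCurve Λ) where
  dist := curveDist
  dist_self f := le_antisymm
    ((curveDist_le f f (Homeomorph.refl I) (Homeomorph.refl I)).trans (dist_self _).le)
    (Real.iInf_nonneg fun _ => dist_nonneg)
  dist_comm f g := by
    have key : ∀ f g : ParamCurve Λ, curveDist f g ≤ curveDist g f := fun f g =>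
      le_ciInf fun p => (curveDist_le f g p.2 p.1).trans (dist_comm _ _).le
    exact le_antisymm (key f g) (key g f)
  dist_triangle := curveDist_triangle

theorem dist_def (f g : ParamCurve Λ) : dist f g = curveDist f g := rfl

theorem continuous_eval (f : ParamCurve Λ) : Continuous f.eval :=
  continuous_subtype_val.comp (show C(I, Λ) from f).continuous

theorem range_eval_subset {f g : ParamCurve Λ} (h : dist f g = 0) :
    Set.range f.eval ⊆ Set.range g.eval := by
  rintro _ ⟨t, rfl⟩
  have hc : IsClosed (Set.range g.eval) := (isCompact_range g.continuous_eval).isClosed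
  rw [← hc.closure_eq, Metric.mem_closure_iff]
  intro ε hε
  obtain ⟨φ, ψ, hφ⟩ := exists_reparam_lt (show curveDist f g < ε from h.trans_lt hε)
  refine ⟨g.eval (ψ (φ.symm t)), ⟨_, rfl⟩, lt_of_le_of_lt ?_ hφ⟩
  have := ContinuousMap.dist_apply_le_dist (f := f.reparam φ) (g := g.reparam ψ) (φ.symm t)
  have e : g.reparam ψ (φ.symm t) = (show C(I, Λ) from g) (ψ (φ.symm t)) := rfl
  have e' : f.reparam φ (φ.symm t) = (show C(I, Λ) from f) t :=
    congrArg (show C(I, Λ) from f) (φ.apply_symm_apply t)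
  rwa [e, e'] at this

end ParamCurve

/-- The space `S_Λ` of curves in `Λ`: parametrized curves up to reparametrization, i.e. the metric
space obtained by identifying parametrized curves at distance zero. -/
abbrev Curve {d : ℕ} (Λ : Set (E d)) : Type := SeparationQuotient (ParamCurve Λ)

namespace Curve

variable {d : ℕ} {Λ : Set (E d)}

/-- `f` is a parametrization of the curve `C`. -/
def IsParam (C : Curve Λ) (f : ParamCurve Λ) : Prop := SeparationQuotient.mk f = C

/-- The set of points of `ℝ^d` visited by the curve. -/
def trace (C : Curve Λ) : Set (E d) := {x | ∃ f, C.IsParam f ∧ x ∈ Set.range f.eval}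

/-- The trace may be computed from any parametrization. -/
theorem trace_mk (f : ParamCurve Λ) :
    trace (SeparationQuotient.mk f : Curve Λ) = Set.range f.eval := by
  ext x
  constructor
  · rintro ⟨g, hg, hx⟩
    exact ParamCurve.range_eval_subset
      (Metric.inseparable_iff.1 (SeparationQuotient.mk_eq_mk.1 hg)) hx
  · exact fun hx => ⟨f, rfl, hx⟩

/-- The diameter of a curve. -/
def diam (C : Curve Λ) : ℝ := Metric.diam C.trace

/-- A curve is rectifiable if it has finite length. -/
def IsRectifiable (C : Curve Λ) : Prop := ∃ f, C.IsParam f ∧ eVariationOn f.eval Set.univ ≠ ∞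

end Curve

/-- The space `Ω_Λ` of configurations: closed sets of curves in `Λ`, with Mathlib's topology of
the Hausdorff (extended) distance. -/
abbrev Config {d : ℕ} (Λ : Set (E d)) : Type := Closeds (Curve Λ)

instance {d : ℕ} (Λ : Set (E d)) : MeasurableSpace (Config Λ) := borel _

instance {d : ℕ} (Λ : Set (E d)) : BorelSpace (Config Λ) := ⟨rfl⟩

/-! ### Cylinders and their crossings -/

/-- A (solid, round) cylinder in `ℝ^d`, given by the centers of its two end faces and
its radius. -/
structure Cylinder (d : ℕ) where
  base : E d
  top : E d
  radius : ℝ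
  base_ne_top : base ≠ top
  radius_pos : 0 < radius

namespace Cylinder

variable {d : ℕ}

def length (A : Cylinder d) : ℝ := dist A.base A.top

/-- The cross-sectional diameter. -/
def width (A : Cylinder d) : ℝ := 2 * A.radius

/-- The slice of the cylinder at relative height `t`: the closed `(d-1)`-dimensional ball
orthogonal to the axis. -/
def slice (A : Cylinder d) (t : ℝ) : Set (E d) :=
  {x | ∃ v : E d, inner ℝ v (A.top - A.base) = 0 ∧ ‖v‖ ≤ A.radius ∧
    x = A.base + t • (A.top - A.base) + v}

def carrier (A : Cylinder d) : Set (E d) := ⋃ t ∈ Set.Icc (0 : ℝ) 1, A.slice t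

end Cylinder

/-- A curve traverses a cylinder in the length direction if one of its segments stays in the
cylinder and joins its two end faces. -/
def Curve.Traverses {d : ℕ} {Λ : Set (E d)} (C : Curve Λ) (A : Cylinder d) : Prop :=
  ∃ f, C.IsParam f ∧ ∃ a b : I, a ≤ b ∧ f.eval a ∈ A.slice 0 ∧ f.eval b ∈ A.slice 1 ∧
    ∀ t ∈ Set.Icc a b, f.eval t ∈ A.carrier

/-- A family of sets is well separated if the distance of each set to the other ones is at least
as large as its diameter. -/
def WellSeparated {d : ℕ} {ι : Type*} (A : ι → Set (E d)) : Prop :=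
  ∀ i j, i ≠ j → ∀ x ∈ A i, ∀ y ∈ A j, Metric.ediam (A i) ≤ edist x y

/-- Hypothesis **H2**: a power bound on the probability of simultaneous crossings of well
separated cylinders of a fixed aspect ratio, uniform in the short-distance cutoff `δ`. -/
def HypothesisH2 {d : ℕ} {Λ : Set (E d)} {δmax : ℝ}
    (μ : Set.Ioc 0 δmax → ProbabilityMeasure (Config Λ)) : Prop :=
  ∃ σ ρ K : ℝ, 0 < σ ∧ 0 ≤ ρ ∧ ρ < 1 ∧
    ∀ (δ : Set.Ioc 0 δmax) (k : ℕ) (A : Fin k → Cylinder d),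
      WellSeparated (fun j => (A j).carrier) →
      (∀ j, (A j).width = σ * (A j).length) →
      (∀ j, (δ : ℝ) ≤ (A j).length) →
      (μ δ : Measure (Config Λ)).real {F | ∀ j, ∃ C ∈ F, C.Traverses (A j)} ≤ K * ρ ^ k

/-! ### Capacity -/

/-- The energy `∬ max(|x-y|, ℓ)^{-s} ν(dx) ν(dy)`, with values in `[0, ∞]`. -/
def energy {d : ℕ} (s ℓ : ℝ) (ν : ProbabilityMeasure (E d)) : ℝ≥0∞ :=
  ∫⁻ x, ∫⁻ y, (max (edist x y) (ENNReal.ofReal ℓ)) ^ (-s) ∂(ν : Measure (E d))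
    ∂(ν : Measure (E d))

/-- The capacity `Cap_{s;ℓ}(A)`: its inverse is the infimum of the energy over the probability
measures supported on `A`. -/
def capacity {d : ℕ} (s ℓ : ℝ) (A : Set (E d)) : ℝ≥0∞ :=
  (⨅ (ν : ProbabilityMeasure (E d)) (_ : (ν : Measure (E d)) Aᶜ = 0), energy s ℓ ν)⁻¹

/-- `T_{s,r;δ}`: the infimum of the capacities `Cap_{s;δ}(C)` over the curves of the configuration
with diameter at least `r` (equal to `∞` if there is no such curve). -/
def minCapacity {d : ℕ} {Λ : Set (E d)} (s r δ : ℝ) (F : Config Λ) : ℝ≥0∞ :=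
  ⨅ (C : Curve Λ) (_ : C ∈ F) (_ : r ≤ C.diam), capacity s δ C.trace

/-! ### Stochastic boundedness -/

/-- A family of `[0, ∞]`-valued functions `X_δ` is stochastically bounded as `δ → 0`. -/
def StochasticallyBounded {Ω : Type*} [MeasurableSpace Ω] {δmax : ℝ}
    (μ : Set.Ioc 0 δmax → ProbabilityMeasure Ω) (X : Set.Ioc 0 δmax → Ω → ℝ≥0∞) : Prop :=
  ∀ ε : ℝ, 0 < ε → ∃ u : ℝ≥0, ∀ δ : Set.Ioc 0 δmax,
    (μ δ : Measure Ω).real {ω | (u : ℝ≥0∞) ≤ X δ ω} ≤ ε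

/-- Stochastically bounded away from zero: the inverse is stochastically bounded. -/
def StochasticallyBoundedAwayFromZero {Ω : Type*} [MeasurableSpace Ω] {δmax : ℝ}
    (μ : Set.Ioc 0 δmax → ProbabilityMeasure Ω) (X : Set.Ioc 0 δmax → Ω → ℝ≥0∞) : Prop :=
  StochasticallyBounded μ (fun δ ω => (X δ ω)⁻¹)

end

end RandomCurves

open RandomCurves

open MeasureTheory Filter Topology TopologicalSpace
open scoped ENNReal NNReal

namespace RandomCurves

noncomputable section

/-! ### Crossings of levels by continuous functions -/

/-! A path that joins two points at distance `L` contains `q ^ 4` pieces of size `L / γ`, `γ = q ^ 4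
+ q`, at mutual distance comparable to their size for fixed `q`. If it also leaves the tube of
radius `2 L / q` around the line through its end points, it contains `q ^ 4 + q ^ 2` of them
(`exists_separatedSegments`). Iterating gives a tree of nested segments (chains). Since `γ` lies
strictly between `q ^ 4` and the geometric mean of the two branching numbers, a path in whose chains
at most half of the levels are straight branches fast enough to have dimension at least `roughDim q
> 1`. Quantitatively, splitting mass equally among the children yields a measure whose energy at
cutoff `δ` is bounded uniformly in `δ` for `s < roughDim q` (`exists_energy_le`).

Straight levels are rare because of **H2**. A straight segment crosses thin cylinders placed along
its axis, and `2 p` of them can be fitted at each level so that the whole family along a chain is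
well separated (`exists_cylinder_family`). If more than half of `k` levels are straight, at least `p
k` cylinders are crossed, which has probability at most `K ρ ^ (p k)` once the approximate positions
of the chain are prescribed. The number of ways to prescribe them is at most a constant times the
`k`-th power of a polynomial in `q`. Taking `q` proportional to `p` and `p` large, `ρ ^ p` beats
this entropy and the bad event at depth `k` has probability of order `2 ^ (-k)`
(`exists_measure_straightEvent_le`, `exists_parameters`). Summing over `k ≥ k₀` gives the capacity
bound.

In the scaling limit, the event that a curve has diameter larger than `r` and minimal energy larger
than `u` at a fixed positive cutoff is open, so its probability passes to the limit
(`ae_exists_minEnergy_le`). Energy bounds uniform in the cutoff imply the dimension bound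
(`le_dimH_of_minEnergy_le`), whereas rectifiable curves have dimension at most one. -/

theorem exists_first_hit {g : ℝ → ℝ} (hg : Continuous g) {a b β : ℝ} (hab : a ≤ b)
    (ha : g a ≤ β) (hb : β ≤ g b) :
    ∃ u ∈ Set.Icc a b, g u = β ∧ ∀ t ∈ Set.Icc a u, g t ≤ β := by
  have hK : IsCompact (Set.Icc a b ∩ g ⁻¹' {β}) :=
    isCompact_Icc.inter_right (isClosed_singleton.preimage hg)
  obtain ⟨t, ht, htβ⟩ := intermediate_value_Icc hab hg.continuousOn ⟨ha, hb⟩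
  obtain ⟨u, ⟨hu, huβ⟩, hmin⟩ := hK.exists_isLeast ⟨t, ht, htβ⟩
  refine ⟨u, hu, huβ, fun t ht => ?_⟩
  by_contra! hlt
  obtain ⟨v, hv, hvβ⟩ := intermediate_value_Icc ht.1 hg.continuousOn ⟨ha, hlt.le⟩
  have h1 : u ≤ v := hmin ⟨⟨hv.1, hv.2.trans (ht.2.trans hu.2)⟩, hvβ⟩
  have h2 : t = v := le_antisymm (ht.2.trans h1) hv.2
  rw [h2] at hlt
  exact hlt.ne' hvβ

theorem exists_last_hit {g : ℝ → ℝ} (hg : Continuous g) {a b α : ℝ} (hab : a ≤ b)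
    (ha : g a ≤ α) (hb : α ≤ g b) :
    ∃ s ∈ Set.Icc a b, g s = α ∧ ∀ t ∈ Set.Icc s b, α ≤ g t := by
  obtain ⟨u, hu, h1, h2⟩ := exists_first_hit (g := fun t => -g (-t)) (β := -α) (by fun_prop)
    (neg_le_neg hab) (by simpa using hb) (by simpa using ha)
  refine ⟨-u, ⟨by linarith [hu.2], by linarith [hu.1]⟩, by linarith, fun t ht => ?_⟩
  have := h2 (-t) ⟨by linarith [ht.2], by linarith [ht.1]⟩
  simpa using this

theorem exists_crossing {g : ℝ → ℝ} (hg : Continuous g) {a b α β : ℝ} (hab : a ≤ b)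
    (ha : g a ≤ α) (hαβ : α ≤ β) (hb : β ≤ g b) :
    ∃ s u, a ≤ s ∧ s ≤ u ∧ u ≤ b ∧ g s = α ∧ g u = β ∧ ∀ t ∈ Set.Icc s u, g t ∈ Set.Icc α β := by
  obtain ⟨u, hu, hu1, hu2⟩ := exists_first_hit hg hab (ha.trans hαβ) hb
  obtain ⟨s, hs, hs1, hs2⟩ := exists_last_hit hg hu.1 ha (hαβ.trans hu1.ge)
  exact ⟨s, u, hs.1, hs.2, hu.2, hs1, hu1,
    fun t ht => ⟨hs2 t ht, hu2 t ⟨hs.1.trans ht.1, ht.2⟩⟩⟩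

/-! ### Separated families of segments of a path -/

section Segments

variable {X : Type*} [MetricSpace X]

/-- The segment of `F` over `[a, b]` joins two points at distance `L` and stays within distance `L`
of its starting point. -/
structure IsSegment (F : ℝ → X) (L a b : ℝ) : Prop where
  le : a ≤ b
  dist_eq : dist (F a) (F b) = L
  dist_le : ∀ t ∈ Set.Icc a b, dist (F a) (F t) ≤ L

theorem exists_isSegment {F : ℝ → X} (hF : Continuous F) {a b L : ℝ} (hab : a ≤ b) (hL : 0 ≤ L)
    (h : L ≤ dist (F a) (F b)) : ∃ v ∈ Set.Icc a b, IsSegment F L a v := by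
  obtain ⟨v, hv, h1, h2⟩ := exists_first_hit (g := fun t => dist (F a) (F t)) (by fun_prop) hab
    (by simpa using hL) h
  exact ⟨v, hv, hv.1, h1, h2⟩

/-- A family of segments of size `L` of the path `F` over `[a, b]`, at mutual distance at
least `κ`. -/
def SeparatedSegments {ι : Type*} (F : ℝ → X) (a b L κ : ℝ) (u v : ι → ℝ) : Prop :=
  (∀ i, a ≤ u i ∧ v i ≤ b ∧ IsSegment F L (u i) (v i)) ∧
    ∀ i j, i ≠ j → ∀ s ∈ Set.Icc (u i) (v i), ∀ t ∈ Set.Icc (u j) (v j), κ ≤ dist (F s) (F t)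

theorem SeparatedSegments.comp {ι ι' : Type*} {F : ℝ → X} {a b L κ : ℝ} {u v : ι → ℝ}
    (h : SeparatedSegments F a b L κ u v) (e : ι' ↪ ι) :
    SeparatedSegments F a b L κ (u ∘ e) (v ∘ e) :=
  ⟨fun i => h.1 (e i), fun i j hij => h.2 (e i) (e j) (e.injective.ne hij)⟩

theorem SeparatedSegments.sumElim {ι ι' : Type*} {F : ℝ → X} {a b L κ : ℝ} {u v : ι → ℝ}
    {u' v' : ι' → ℝ} (h : SeparatedSegments F a b L κ u v) (h' : SeparatedSegments F a b L κ u' v')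
    (hd : ∀ i j, ∀ s ∈ Set.Icc (u i) (v i), ∀ t ∈ Set.Icc (u' j) (v' j), κ ≤ dist (F s) (F t)) :
    SeparatedSegments F a b L κ (Sum.elim u u') (Sum.elim v v') := by
  refine ⟨?_, ?_⟩
  · rintro (i | i)
    · exact h.1 i
    · exact h'.1 i
  · rintro (i | i) (j | j) hij s hs t ht
    · exact h.2 i j (by simpa using hij) s hs t ht
    · exact hd i j s hs t ht
    · rw [dist_comm]; exact hd j i t ht s hs
    · exact h'.2 i j (by simpa using hij) s hs t ht

/-- Loop erasure: times `t 0, t 1, …` at which the path has moved by `η`, never to return to the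
`η`-ball of the previous points. -/
theorem exists_loopErased {F : ℝ → X} (hF : Continuous F) {a b η : ℝ} (hab : a ≤ b) (hη : 0 < η)
    (N : ℕ) :
    ∃ n ≤ N, ∃ t : ℕ → ℝ, t 0 = a ∧ (∀ i ≤ n, t i ∈ Set.Icc a b) ∧
      (∀ i < n, t i ≤ t (i + 1)) ∧ (∀ i < n, dist (F (t i)) (F (t (i + 1))) = η) ∧
      (∀ i < n, ∀ s ∈ Set.Icc (t (i + 1)) b, η ≤ dist (F (t i)) (F s)) ∧
      (n < N → dist (F (t n)) (F b) < η) := by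
  induction N with
  | zero => exact ⟨0, le_rfl, fun _ => a, rfl, fun i _ => ⟨le_rfl, hab⟩, by simp⟩
  | succ N ih =>
    obtain ⟨n, hn, t, h0, h1, h2, h3, h4, h5⟩ := ih
    by_cases hlt : dist (F (t n)) (F b) < η
    · exact ⟨n, by omega, t, h0, h1, h2, h3, h4, fun _ => hlt⟩
    · have hnN : n = N := by
        by_contra hne
        exact hlt (h5 (by omega))
      subst hnN
      -- The last visit to the sphere of radius `η`, not the first: this is what erases the loops.
      obtain ⟨s, hs, hs1, hs2⟩ := exists_last_hit (g := fun x => dist (F (t n)) (F x))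
        (by fun_prop) (h1 n le_rfl).2 (by simpa using hη.le) (not_lt.1 hlt)
      have e : ∀ i ≤ n, Function.update t (n + 1) s i = t i := fun i hi =>
        Function.update_of_ne (by omega) _ _
      refine ⟨n + 1, le_rfl, Function.update t (n + 1) s, ?_, ?_, ?_, ?_, ?_, by simp⟩
      · rw [e 0 (by omega), h0]
      · intro i hi
        rcases Nat.lt_or_ge i (n + 1) with h | h
        · rw [e i (by omega)]; exact h1 i (by omega)
        · obtain rfl : i = n + 1 := by omega
          simpa using ⟨(h1 n le_rfl).1.trans hs.1, hs.2⟩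
      all_goals
        intro i hi
        rw [e i (by omega)]
        rcases Nat.lt_or_ge i n with h | h
        · rw [e (i + 1) (by omega)]
          first
            | exact h2 i h
            | exact h3 i h
            | exact h4 i h
        · obtain rfl : i = n := by omega
          rw [Function.update_self]
          first
            | exact hs.1
            | exact hs1
            | exact hs2

theorem dist_loopErased_le {F : ℝ → X} {η : ℝ} {n : ℕ} {t : ℕ → ℝ}
    (h : ∀ i < n, dist (F (t i)) (F (t (i + 1))) = η) {i j : ℕ} (hij : i ≤ j) (hj : j ≤ n) :
    dist (F (t i)) (F (t j)) ≤ (j - i : ℕ) * η := by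
  refine (dist_le_Ico_sum_of_dist_le (f := fun k => F (t k)) (d := fun _ => η) hij
    fun {k} _ hk => (h k (by omega)).le).trans ?_
  simp

theorem monotone_loopErased {n : ℕ} {t : ℕ → ℝ} (h : ∀ i < n, t i ≤ t (i + 1)) {i j : ℕ}
    (hij : i ≤ j) (hj : j ≤ n) : t i ≤ t j := by
  induction j, hij using Nat.le_induction with
  | base => exact le_rfl
  | succ j hij ih => exact (ih (by omega)).trans (h j (by omega))

/-- The segments that start at the loop-erased times. -/
theorem separatedSegments_loopErased {F : ℝ → X} (hF : Continuous F) {a b η L : ℝ} (hL : 0 ≤ L)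
    (hLη : L ≤ η) {n : ℕ} {t : ℕ → ℝ} (h1 : ∀ i ≤ n, t i ∈ Set.Icc a b)
    (h2 : ∀ i < n, t i ≤ t (i + 1)) (h3 : ∀ i < n, dist (F (t i)) (F (t (i + 1))) = η)
    (h4 : ∀ i < n, ∀ s ∈ Set.Icc (t (i + 1)) b, η ≤ dist (F (t i)) (F s)) :
    ∃ v : Fin n → ℝ, SeparatedSegments F a b L (η - L) (fun i : Fin n => t i) v := by
  have hex : ∀ i : Fin n, ∃ v ∈ Set.Icc (t i) (t (i + 1)), IsSegment F L (t i) v := fun i =>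
    exists_isSegment hF (h2 i i.2) hL (hLη.trans (h3 i i.2).ge)
  choose v hv hseg using hex
  have key : ∀ i j : Fin n, i < j → ∀ s ∈ Set.Icc (t i) (v i), ∀ x ∈ Set.Icc (t j) (v j),
      η - L ≤ dist (F s) (F x) := by
    intro i j hij s hs x hx
    have hij' : (i : ℕ) + 1 ≤ j := hij
    -- Segment `i` stays within `L` of `F (t i)`, while everything after time `t (i + 1)` is at
    -- distance at least `η` from that point.
    have a1 := (hseg i).dist_le s hs
    have a2 := h4 i i.2 x ⟨(monotone_loopErased h2 hij' j.2.le).trans hx.1,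
      hx.2.trans ((hv j).2.trans (h1 _ j.2).2)⟩
    have a3 := dist_triangle (F (t i)) (F s) (F x)
    linarith
  refine ⟨v, fun i => ⟨(h1 i i.2.le).1, (hv i).2.trans (h1 _ i.2).2, hseg i⟩, ?_⟩
  intro i j hij s hs x hx
  rcases lt_or_gt_of_ne hij with h | h
  · exact key i j h s hs x hx
  · rw [dist_comm]; exact key j i h x hx s hs

/-- Crossings of the slabs `[α + j η, α + j η + L]` of a `1`-Lipschitz function. -/
theorem separatedSegments_slabs {F : ℝ → X} (hF : Continuous F) {ρ : X → ℝ}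
    (hρ : LipschitzWith 1 ρ) {a b α η L : ℝ} (hab : a ≤ b) (hL : 0 ≤ L) (hLη : L ≤ η) {J : ℕ}
    (ha : ρ (F a) ≤ α) (hb : α + J * η ≤ ρ (F b)) :
    ∃ u v : Fin J → ℝ, SeparatedSegments F a b L (η - L) u v ∧
      ∀ i, ∀ s ∈ Set.Icc (u i) (v i), α ≤ ρ (F s) := by
  have hη : 0 ≤ η := hL.trans hLη
  have hlip : ∀ x y, |ρ x - ρ y| ≤ dist x y := fun x y => by
    simpa [Real.dist_eq] using hρ.dist_le_mul x y
  have hex : ∀ j : Fin J, ∃ u v, a ≤ u ∧ v ≤ b ∧ IsSegment F L u v ∧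
      ∀ s ∈ Set.Icc u v, ρ (F s) ∈ Set.Icc (α + j * η) (α + j * η + L) := by
    intro j
    have hj : ((j : ℕ) : ℝ) + 1 ≤ J := by exact_mod_cast j.2
    have h0 : 0 ≤ ((j : ℕ) : ℝ) * η := by positivity
    have h1 : (((j : ℕ) : ℝ) + 1) * η ≤ J * η := mul_le_mul_of_nonneg_right hj hη
    obtain ⟨s, u, has, hsu, hub, hs, hu, h⟩ := exists_crossing (g := fun t => ρ (F t))
      (hρ.continuous.comp hF) hab (α := α + j * η) (β := α + j * η + L)
      (by linarith) (by linarith) (by linarith)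
    have hd : L ≤ dist (F s) (F u) := by
      have := hlip (F u) (F s)
      rw [dist_comm] at this
      refine le_trans ?_ this
      rw [show ρ (F u) - ρ (F s) = L by linarith]
      exact le_abs_self L
    obtain ⟨v, hv, hseg⟩ := exists_isSegment hF hsu hL hd
    exact ⟨s, v, has, hv.2.trans hub, hseg, fun x hx => h x ⟨hx.1, hx.2.trans hv.2⟩⟩
  choose u v h1 h2 h3 h4 using hex
  have key : ∀ i j : Fin J, i < j → ∀ s ∈ Set.Icc (u i) (v i), ∀ x ∈ Set.Icc (u j) (v j),
      η - L ≤ dist (F s) (F x) := by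
    intro i j hij s hs x hx
    have a1 := (h4 i s hs).2
    have a2 := (h4 j x hx).1
    have a3 := hlip (F x) (F s)
    rw [dist_comm] at a3
    have a4 := le_abs_self (ρ (F x) - ρ (F s))
    have hj : ((i : ℕ) : ℝ) + 1 ≤ (j : ℕ) := by exact_mod_cast hij
    have a5 : (((i : ℕ) : ℝ) + 1) * η ≤ (j : ℕ) * η := mul_le_mul_of_nonneg_right hj hη
    linarith
  refine ⟨u, v, ⟨fun i => ⟨h1 i, h2 i, h3 i⟩, ?_⟩, ?_⟩
  · intro i j hij s hs x hx
    rcases lt_or_gt_of_ne hij with h | h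
    · exact key i j h s hs x hx
    · rw [dist_comm]; exact key j i h x hx s hs
  · intro i s hs
    have h0 : 0 ≤ ((i : ℕ) : ℝ) * η := by positivity
    linarith [(h4 i s hs).1]

end Segments

/-! ### Distance to a line and straight segments -/

section Straight

variable {V : Type*} [NormedAddCommGroup V] [InnerProductSpace ℝ V]

/-- The distance of `z` to the line through `x` and `y`. -/
def lineDist (x y z : V) : ℝ := Metric.infDist z (Set.range fun c : ℝ => x + c • (y - x))

theorem lipschitzWith_lineDist (x y : V) : LipschitzWith 1 (lineDist x y) :=
  Metric.lipschitz_infDist_pt _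

theorem lineDist_self_left (x y : V) : lineDist x y x = 0 :=
  Metric.infDist_zero_of_mem ⟨0, by simp⟩

theorem lineDist_le (x y z : V) (c : ℝ) : lineDist x y z ≤ ‖z - (x + c • (y - x))‖ := by
  rw [← dist_eq_norm]
  exact Metric.infDist_le_dist_of_mem ⟨c, rfl⟩

/-- The orthogonal decomposition of `z - x` with respect to `e`. -/
theorem exists_orthogonal_decomposition (e u : V) :
    ∃ (c : ℝ) (w : V), u = c • e + w ∧ inner ℝ w e = 0 := by
  by_cases he : e = 0
  · exact ⟨0, u, by simp, by simp [he]⟩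
  · refine ⟨inner ℝ u e / ‖e‖ ^ 2, u - (inner ℝ u e / ‖e‖ ^ 2) • e, by simp, ?_⟩
    have : ‖e‖ ^ 2 ≠ 0 := by positivity
    rw [inner_sub_left, real_inner_smul_left, real_inner_self_eq_norm_sq, div_mul_cancel₀ _ this,
      sub_self]

theorem norm_sq_smul_add_of_inner_eq_zero {e w : V} (h : inner ℝ w e = 0) (c : ℝ) :
    ‖c • e + w‖ ^ 2 = c ^ 2 * ‖e‖ ^ 2 + ‖w‖ ^ 2 := by
  rw [norm_add_sq_real, real_inner_smul_left, real_inner_comm, h, norm_smul, mul_pow,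
    Real.norm_eq_abs, sq_abs]
  ring

/-- Ellipse inequality: among the points at a given distance from the line, the sum of the distances
to `x` and `y` is least above the midpoint. It turns a nearly minimal detour into proximity to the
line. -/
theorem dist_sq_add_four_mul_lineDist_sq_le (x y z : V) :
    dist x y ^ 2 + 4 * lineDist x y z ^ 2 ≤ (dist x z + dist z y) ^ 2 := by
  obtain ⟨c, w, hz, hw⟩ := exists_orthogonal_decomposition (y - x) (z - x)
  have h1 : dist x z ^ 2 = c ^ 2 * ‖y - x‖ ^ 2 + ‖w‖ ^ 2 := by
    rw [dist_comm, dist_eq_norm, hz, norm_sq_smul_add_of_inner_eq_zero hw]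
  have h2 : dist z y ^ 2 = (c - 1) ^ 2 * ‖y - x‖ ^ 2 + ‖w‖ ^ 2 := by
    rw [dist_eq_norm, ← norm_sq_smul_add_of_inner_eq_zero hw]
    congr 2
    rw [show z - y = (z - x) - (y - x) by abel, hz, sub_smul, one_smul]
    abel
  have h3 : lineDist x y z ≤ ‖w‖ := by
    refine (lineDist_le x y z c).trans_eq ?_
    rw [show z - (x + c • (y - x)) = (z - x) - c • (y - x) by abel, hz, add_sub_cancel_left]
  have h0 : 0 ≤ lineDist x y z := Metric.infDist_nonneg
  have h4 : dist x y = ‖y - x‖ := by rw [dist_comm, dist_eq_norm]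
  have h5 : lineDist x y z ^ 2 ≤ ‖w‖ ^ 2 := pow_le_pow_left₀ h0 h3 2
  -- Cauchy–Schwarz for the plane vectors `(|c| ‖y - x‖, ‖w‖)` and `(|c - 1| ‖y - x‖, ‖w‖)`.
  have h6 : |c * (c - 1)| * ‖y - x‖ ^ 2 + ‖w‖ ^ 2 ≤ dist x z * dist z y := by
    refine abs_le_of_sq_le_sq' ?_ (by positivity) |>.2
    rw [mul_pow, h1, h2]
    have : |c * (c - 1)| ^ 2 = c ^ 2 * (c - 1) ^ 2 := by rw [sq_abs]; ring
    have h7 : 2 * |c * (c - 1)| ≤ c ^ 2 + (c - 1) ^ 2 := by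
      rw [abs_mul]
      nlinarith [sq_nonneg (|c| - |c - 1|), sq_abs c, sq_abs (c - 1)]
    have h8 := mul_le_mul_of_nonneg_right h7 (show 0 ≤ ‖y - x‖ ^ 2 * ‖w‖ ^ 2 by positivity)
    linear_combination h8 + ‖y - x‖ ^ 4 * this
  have h9 : -(c * (c - 1)) ≤ |c * (c - 1)| := neg_le_abs _
  have h10 := mul_le_mul_of_nonneg_right h9 (sq_nonneg ‖y - x‖)
  have h11 := le_abs_self (c * (c - 1))
  rw [h4]
  nlinarith

/-- The path stays over `[a, b]` within distance `w` of the line through its end points. -/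
def IsStraight (F : ℝ → V) (w a b : ℝ) : Prop :=
  ∀ t ∈ Set.Icc a b, lineDist (F a) (F b) (F t) ≤ w

/-- The branching step. Loop erasure with step `η = L / q ^ 4` needs at least `q ^ 4` moves to cover
the distance `L`. If it stops before `q ^ 4 + q ^ 2` moves, the erased path is nearly minimal and
stays within `L / q` of the line, so an excursion beyond `2 L / q` supplies about `q ^ 3` further
segments, well away from the others. -/
theorem exists_separatedSegments {F : ℝ → V} (hF : Continuous F) {q : ℕ} (hq : 3 ≤ q) {a b L : ℝ}
    (hL : 0 < L) (hab : a ≤ b) (hd : dist (F a) (F b) = L) :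
    (∃ u v : Fin (q ^ 4) → ℝ,
      SeparatedSegments F a b (L / (q ^ 4 + q)) (L / q ^ 4 - L / (q ^ 4 + q)) u v) ∧
    (¬ IsStraight F (2 * L / q) a b → ∃ u v : Fin (q ^ 4 + q ^ 2) → ℝ,
      SeparatedSegments F a b (L / (q ^ 4 + q)) (L / q ^ 4 - L / (q ^ 4 + q)) u v) := by
  have hq0 : (3 : ℝ) ≤ q := by exact_mod_cast hq
  have hqp : (0 : ℝ) < q := by linarith
  set η : ℝ := L / q ^ 4 with hηdef
  set L' : ℝ := L / (q ^ 4 + q) with hL'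
  have hη : 0 < η := by positivity
  have hL'0 : 0 ≤ L' := by positivity
  have hL'η : L' ≤ η := by
    apply div_le_div_of_nonneg_left hL.le (by positivity); linarith
  have hLη : L = q ^ 4 * η := by rw [hηdef]; field_simp
  -- After `n` moves the path is at most `n η` from its start and less than `η` from its end, so `q
  -- ^ 4 * η = L < (n + 1) * η`.
  have long : ∀ (n : ℕ) (t : ℕ → ℝ), t 0 = a → (∀ i < n, dist (F (t i)) (F (t (i + 1))) = η) →
      dist (F (t n)) (F b) < η → q ^ 4 ≤ n := by
    intro n t h0 h3 h5
    have a1 := dist_loopErased_le (F := F) h3 (Nat.zero_le n) le_rfl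
    have a2 := dist_triangle (F (t 0)) (F (t n)) (F b)
    rw [h0, hd] at a2
    rw [h0, Nat.sub_zero] at a1
    have : (q : ℝ) ^ 4 * η < (n + 1) * η := by linarith
    have := lt_of_mul_lt_mul_right this hη.le
    have : q ^ 4 < n + 1 := by exact_mod_cast this
    omega
  constructor
  · obtain ⟨n, hn, t, h0, h1, h2, h3, h4, h5⟩ := exists_loopErased hF hab hη (q ^ 4)
    obtain ⟨v, hv⟩ := separatedSegments_loopErased hF hL'0 hL'η h1 h2 h3 h4
    have hnq : n = q ^ 4 := by
      rcases hn.lt_or_eq with h | h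
      · exact absurd (long n t h0 h3 (h5 h)) (by omega)
      · exact h
    subst hnq
    exact ⟨_, v, hv⟩
  · intro hns
    obtain ⟨n, hn, t, h0, h1, h2, h3, h4, h5⟩ := exists_loopErased hF hab hη (q ^ 4 + q ^ 2)
    obtain ⟨v, hv⟩ := separatedSegments_loopErased hF hL'0 hL'η h1 h2 h3 h4
    rcases hn.lt_or_eq with hlt | rfl
    swap
    · exact ⟨_, v, hv⟩
    have hnq := long n t h0 h3 (h5 hlt)
    simp only [IsStraight, not_forall, not_le] at hns
    obtain ⟨T, hT, hTw⟩ := hns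
    set ρ := lineDist (F a) (F b) with hρ
    have hlip : ∀ x y, |ρ x - ρ y| ≤ dist x y := fun x y => by
      simpa [Real.dist_eq] using (lipschitzWith_lineDist (F a) (F b)).dist_le_mul x y
    -- The detour through `F (t i)` costs at most `(n + 1) η ≤ (q ^ 4 + q ^ 2) η`. By the ellipse
    -- inequality, four times the squared distance to the line is at most `(2 q ^ 6 + q ^ 4) η ^ 2 ≤
    -- 4 (q ^ 3 η) ^ 2`, and `q ^ 3 η = L / q`.
    have hnear : ∀ i ≤ n, ρ (F (t i)) ≤ L / q := by
      intro i hi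
      have a1 := dist_loopErased_le (F := F) h3 (Nat.zero_le i) hi
      have a2 := dist_loopErased_le (F := F) h3 hi le_rfl
      have a3 := dist_triangle (F (t i)) (F (t n)) (F b)
      have a4 := h5 hlt
      have a5 := dist_sq_add_four_mul_lineDist_sq_le (F a) (F b) (F (t i))
      rw [h0, Nat.sub_zero] at a1
      rw [Nat.cast_sub hi] at a2
      have hn1 : ((n : ℝ) + 1) ≤ q ^ 4 + q ^ 2 := by exact_mod_cast hlt
      have a6 : dist (F a) (F (t i)) + dist (F (t i)) (F b) ≤ (q ^ 4 + q ^ 2) * η := by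
        have := mul_le_mul_of_nonneg_right hn1 hη.le
        linarith
      have a7 : (dist (F a) (F (t i)) + dist (F (t i)) (F b)) ^ 2 ≤ ((q ^ 4 + q ^ 2) * η) ^ 2 :=
        pow_le_pow_left₀ (by positivity) a6 2
      rw [hd, ← hρ, hLη] at a5
      have a8 : L / q = q ^ 3 * η := by rw [hLη]; field_simp
      rw [a8]
      refine abs_le_of_sq_le_sq' ?_ (by positivity) |>.2
      have a9 : (q : ℝ) ^ 4 ≤ 2 * q ^ 6 := by
        have : (1 : ℝ) ≤ q ^ 2 := one_le_pow₀ (by linarith)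
        nlinarith [pow_pos hqp 4]
      have a10 := mul_le_mul_of_nonneg_right a9 (sq_nonneg η)
      nlinarith
    -- The range from `L / q` to `2 L / q` has room for `q ^ 3` slabs of height `η`. The lowest is
    -- given up: segments that start within `L / q` of the line rise by at most `L'`, which leaves
    -- the gap `η - L'`. The loss is harmless since `q ^ 3 - 1 ≥ q ^ 2`.
    obtain ⟨u', v', hs', hfar⟩ := separatedSegments_slabs hF (lipschitzWith_lineDist (F a) (F b))
      (α := L / q + η) (η := η) (J := q ^ 3 - 1) hT.1 hL'0 hL'η
      (by rw [lineDist_self_left]; positivity) (by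
        have : 1 ≤ q ^ 3 := Nat.one_le_pow _ _ (by omega)
        have e : 2 * L / q = L / q + q ^ 3 * η := by rw [hLη]; field_simp; norm_num
        rw [← hρ]
        push_cast [Nat.cast_sub this]
        linarith)
    have hs'' : SeparatedSegments F a b L' (η - L') u' v' :=
      ⟨fun i => ⟨(hs'.1 i).1, (hs'.1 i).2.1.trans hT.2, (hs'.1 i).2.2⟩, hs'.2⟩
    have hsum := hv.sumElim hs'' (by
      intro i j s hs x hx
      have a1 := hnear i i.2.le
      have a2 := (hv.1 i).2.2.dist_le s hs
      have a3 := hfar j x hx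
      rw [← hρ] at a3
      have a4 := (abs_le.1 (hlip (F (t i)) (F s))).1
      have a5 := (abs_le.1 (hlip (F s) (F x))).1
      linarith)
    have hcard : Fintype.card (Fin (q ^ 4 + q ^ 2)) ≤ Fintype.card (Fin n ⊕ Fin (q ^ 3 - 1)) := by
      simp only [Fintype.card_sum, Fintype.card_fin]
      have : q ^ 2 + 1 ≤ q ^ 3 := by nlinarith [Nat.pow_le_pow_left hq 2]
      omega
    obtain ⟨e⟩ := Function.Embedding.nonempty_of_card_le hcard
    exact ⟨_, _, hsum.comp e⟩

end Straight

/-! ### Energy of mixtures -/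

section Energy

variable {d : ℕ}

theorem rpow_neg_le_rpow_neg {x y : ℝ≥0∞} {s : ℝ} (hs : 0 ≤ s) (h : x ≤ y) :
    y ^ (-s) ≤ x ^ (-s) := by
  rw [ENNReal.rpow_neg, ENNReal.rpow_neg]
  exact ENNReal.inv_le_inv.2 (ENNReal.rpow_le_rpow h hs)

theorem measurable_energyKernel (s ℓ : ℝ) :
    Measurable fun p : E d × E d => (max (edist p.1 p.2) (ENNReal.ofReal ℓ)) ^ (-s) :=
  (measurable_edist.max measurable_const).pow_const _

theorem energy_dirac (s ℓ : ℝ) (x : E d) :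
    energy s ℓ ⟨Measure.dirac x, inferInstance⟩ = ENNReal.ofReal ℓ ^ (-s) := by
  simp [energy]

/-- Take the uniform mixture of the `ν i`: the diagonal terms give the averaged energies with one
additional factor `1 / N`, and each off-diagonal term is at most `κ ^ (-s)` by separation. -/
theorem exists_mixture {ι : Type*} [Fintype ι] [Nonempty ι] {s : ℝ} (hs : 0 ≤ s) (ℓ κ : ℝ)
    (ν : ι → ProbabilityMeasure (E d)) (S : ι → Set (E d))
    (hν : ∀ i, (ν i : Measure (E d)) (S i)ᶜ = 0)
    (hS : ∀ i j, i ≠ j → ∀ x ∈ S i, ∀ y ∈ S j, κ ≤ dist x y) :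
    ∃ ν' : ProbabilityMeasure (E d),
      (∀ A, (∀ i, S i ⊆ A) → (ν' : Measure (E d)) Aᶜ = 0) ∧
      energy s ℓ ν' ≤ (Fintype.card ι : ℝ≥0∞)⁻¹ * ((Fintype.card ι : ℝ≥0∞)⁻¹ *
        ∑ i, energy s ℓ (ν i)) + ENNReal.ofReal κ ^ (-s) := by
  set N : ℝ≥0∞ := (Fintype.card ι : ℝ≥0∞) with hN
  have hN0 : N ≠ 0 := by simp [hN]
  have hNt : N ≠ ∞ := by simp [hN]
  let m : Measure (E d) := N⁻¹ • ∑ i, (ν i : Measure (E d))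
  have hm : IsProbabilityMeasure m := ⟨by
    simp [m, ← hN, ENNReal.inv_mul_cancel hN0 hNt]⟩
  refine ⟨⟨m, hm⟩, fun A hA => ?_, ?_⟩
  · have : ∀ i, (ν i : Measure (E d)) Aᶜ = 0 := fun i =>
      measure_mono_null (Set.compl_subset_compl.2 (hA i)) (hν i)
    change m Aᶜ = 0
    simp only [m, Measure.smul_apply, Measure.finsetSum_apply, this, Finset.sum_const_zero,
      smul_zero]
  · have hmeas := measurable_energyKernel (d := d) s ℓ
    set k : E d → E d → ℝ≥0∞ := fun x y => (max (edist x y) (ENNReal.ofReal ℓ)) ^ (-s) with hk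
    have hk2 : ∀ j, Measurable fun x => ∫⁻ y, k x y ∂(ν j : Measure (E d)) := fun j =>
      hmeas.lintegral_prod_right'
    have e1 : energy s ℓ ⟨m, hm⟩ = N⁻¹ * ∑ i, N⁻¹ * ∑ j,
        ∫⁻ x, ∫⁻ y, k x y ∂(ν j : Measure (E d)) ∂(ν i : Measure (E d)) := by
      change ∫⁻ x, ∫⁻ y, k x y ∂m ∂m = _
      simp only [m, lintegral_smul_measure, lintegral_finsetSum_measure, smul_eq_mul]
      congr 1
      refine Finset.sum_congr rfl fun i _ => ?_
      rw [lintegral_const_mul _ (Finset.measurable_fun_sum _ fun j _ => hk2 j),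
        lintegral_finsetSum _ fun j _ => hk2 j]
    have cross : ∀ i j, i ≠ j →
        ∫⁻ x, ∫⁻ y, k x y ∂(ν j : Measure (E d)) ∂(ν i : Measure (E d))
          ≤ ENNReal.ofReal κ ^ (-s) := by
      intro i j hij
      have hi : ∀ᵐ x ∂(ν i : Measure (E d)), x ∈ S i := ae_iff.2 (hν i)
      have hj : ∀ᵐ x ∂(ν j : Measure (E d)), x ∈ S j := ae_iff.2 (hν j)
      calc ∫⁻ x, ∫⁻ y, k x y ∂(ν j : Measure (E d)) ∂(ν i : Measure (E d))
          ≤ ∫⁻ x, ∫⁻ y, ENNReal.ofReal κ ^ (-s) ∂(ν j : Measure (E d))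
              ∂(ν i : Measure (E d)) := by
            refine lintegral_mono_ae ?_
            filter_upwards [hi] with x hx
            refine lintegral_mono_ae ?_
            filter_upwards [hj] with y hy
            refine rpow_neg_le_rpow_neg hs (le_max_of_le_left ?_)
            rw [edist_dist]
            exact ENNReal.ofReal_le_ofReal (hS i j hij x hx y hy)
        _ = ENNReal.ofReal κ ^ (-s) := by simp
    have row : ∀ i, ∑ j, ∫⁻ x, ∫⁻ y, k x y ∂(ν j : Measure (E d)) ∂(ν i : Measure (E d))
        ≤ energy s ℓ (ν i) + N * ENNReal.ofReal κ ^ (-s) := by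
      intro i
      classical
      rw [← Finset.add_sum_erase _ _ (Finset.mem_univ i)]
      refine add_le_add le_rfl ?_
      refine (Finset.sum_le_card_nsmul _ _ (ENNReal.ofReal κ ^ (-s)) fun j hj => ?_).trans ?_
      · exact cross i j (Finset.ne_of_mem_erase hj).symm
      · rw [nsmul_eq_mul]
        gcongr
        simp only [hN]
        exact_mod_cast Finset.card_le_univ _
    rw [e1]
    calc N⁻¹ * ∑ i, N⁻¹ * ∑ j, ∫⁻ x, ∫⁻ y, k x y ∂(ν j : Measure (E d)) ∂(ν i : Measure (E d))
        ≤ N⁻¹ * ∑ i, N⁻¹ * (energy s ℓ (ν i) + N * ENNReal.ofReal κ ^ (-s)) := by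
          gcongr with i; exact row i
      _ = N⁻¹ * (N⁻¹ * ∑ i, energy s ℓ (ν i)) +
            (N⁻¹ * N) * ((N⁻¹ * N) * ENNReal.ofReal κ ^ (-s)) := by
          rw [← Finset.mul_sum, Finset.sum_add_distrib, Finset.sum_const, Finset.card_univ,
            nsmul_eq_mul, ← hN]
          ring
      _ = _ := by rw [ENNReal.inv_mul_cancel hN0 hNt, one_mul, one_mul]

end Energy

/-! ### Nested chains of segments -/

/-- Nested segments of the path `F` over the unit interval, of sizes `L 0, …, L k`. -/
structure IsChain {X : Type*} [MetricSpace X] (F : ℝ → X) (L : ℕ → ℝ) (k : ℕ) (a b : ℕ → ℝ) :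
    Prop where
  zero_le : 0 ≤ a 0
  le_one : b 0 ≤ 1
  seg : ∀ i ≤ k, IsSegment F (L i) (a i) (b i)
  nested : ∀ i < k, a i ≤ a (i + 1) ∧ b (i + 1) ≤ b i

section Chain

variable {d : ℕ}

open Classical in
/-- The product of the branching probabilities along a chain. -/
def chainWeight (F : ℝ → E d) (q : ℕ) (L : ℕ → ℝ) (k : ℕ) (a b : ℕ → ℝ) : ℝ≥0∞ :=
  ∏ i ∈ Finset.range k, if IsStraight F (2 * L i / q) (a i) (b i) then ((q ^ 4 : ℕ) : ℝ≥0∞)⁻¹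
    else ((q ^ 4 + q ^ 2 : ℕ) : ℝ≥0∞)⁻¹

theorem IsChain.update {X : Type*} [MetricSpace X] {F : ℝ → X} {L : ℕ → ℝ} {k : ℕ} {a b : ℕ → ℝ}
    (h : IsChain F L k a b) {u v : ℝ} (hu : a k ≤ u) (hv : v ≤ b k)
    (hs : IsSegment F (L (k + 1)) u v) :
    IsChain F L (k + 1) (Function.update a (k + 1) u) (Function.update b (k + 1) v) := by
  have e : ∀ (c : ℕ → ℝ) x, ∀ i ≤ k, Function.update c (k + 1) x i = c i := fun c x i hi =>
    Function.update_of_ne (by omega) _ _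
  refine ⟨by rw [e _ _ _ (Nat.zero_le k)]; exact h.zero_le,
    by rw [e _ _ _ (Nat.zero_le k)]; exact h.le_one, ?_, ?_⟩
  · intro i hi
    rcases Nat.lt_or_ge i (k + 1) with h' | h'
    · rw [e _ _ _ (by omega), e _ _ _ (by omega)]; exact h.seg i (by omega)
    · obtain rfl : i = k + 1 := by omega
      simpa using hs
  · intro i hi
    rw [e _ _ i (by omega), e _ _ i (by omega)]
    rcases Nat.lt_or_ge i k with h' | h'
    · rw [e _ _ _ (by omega), e _ _ _ (by omega)]; exact h.nested i h'
    · obtain rfl : i = k := by omega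
      simpa using ⟨hu, hv⟩

theorem chainWeight_congr {F : ℝ → E d} {q : ℕ} {L : ℕ → ℝ} {k : ℕ} {a b a' b' : ℕ → ℝ}
    (ha : ∀ i < k, a i = a' i) (hb : ∀ i < k, b i = b' i) :
    chainWeight F q L k a b = chainWeight F q L k a' b' := by
  refine Finset.prod_congr rfl fun i hi => ?_
  rw [ha i (Finset.mem_range.1 hi), hb i (Finset.mem_range.1 hi)]

/-- Backward induction from depth `n`, where a Dirac mass has energy `ℓ ^ (-s)`. Multiplying the
energy by the chain weight `W` makes the recursion close: in the mixture bound the additional factor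
`1 / N` turns `W` into the weight of the child chain. Each level then adds `W κ ^ (-s)`, and only
here and at depth `n` is the bound `B` on the weights used. The averages over children introduce no
further factor. -/
theorem exists_measure_chainWeight_mul_energy_le {F : ℝ → E d} (hF : Continuous F) {q : ℕ}
    (hq : 3 ≤ q) {s : ℝ} (hs : 0 ≤ s) (ℓ : ℝ) {L : ℕ → ℝ} (hL : ∀ i, 0 < L i)
    (hLs : ∀ i, L (i + 1) = L i / (q ^ 4 + q)) {n : ℕ} {B : ℕ → ℝ≥0∞}
    (hB : ∀ k ≤ n, ∀ a b, IsChain F L k a b → chainWeight F q L k a b ≤ B k) (j : ℕ) :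
    ∀ k, k + j = n → ∀ a b, IsChain F L k a b → ∃ ν : ProbabilityMeasure (E d),
      (ν : Measure (E d)) (F '' Set.Icc (a k) (b k))ᶜ = 0 ∧
      chainWeight F q L k a b * energy s ℓ ν ≤ ∑ i ∈ Finset.Ico k n,
        B i * ENNReal.ofReal (L i / q ^ 4 - L i / (q ^ 4 + q)) ^ (-s)
          + B n * ENNReal.ofReal ℓ ^ (-s) := by
  induction j with
  | zero =>
    intro k hk a b h
    obtain rfl : k = n := by omega
    refine ⟨⟨Measure.dirac (F (a k)), inferInstance⟩, ?_, ?_⟩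
    · have : F (a k) ∈ F '' Set.Icc (a k) (b k) :=
        ⟨_, ⟨le_rfl, (h.seg k le_rfl).le⟩, rfl⟩
      change Measure.dirac (F (a k)) _ = 0
      rw [Measure.dirac_apply, Set.indicator_of_notMem (Set.notMem_compl_iff.2 this)]
    · rw [energy_dirac]
      simp only [Finset.Ico_self, Finset.sum_empty, zero_add]
      gcongr
      exact hB k le_rfl a b h
  | succ j ih =>
    intro k hk a b h
    have hseg := h.seg k le_rfl
    have hsplit := exists_separatedSegments hF hq (hL k) hseg.le hseg.dist_eq
    rw [← hLs] at hsplit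
    set κ : ℝ := L k / q ^ 4 - L (k + 1) with hκ
    obtain ⟨N, hN, u, v, huv, hW⟩ : ∃ (N : ℕ) (_ : 0 < N) (u v : Fin N → ℝ),
        SeparatedSegments F (a k) (b k) (L (k + 1)) κ u v ∧ ∀ i,
          chainWeight F q L (k + 1) (Function.update a (k + 1) (u i))
            (Function.update b (k + 1) (v i)) = chainWeight F q L k a b * (N : ℝ≥0∞)⁻¹ := by
      have hw : ∀ x y, chainWeight F q L k (Function.update a (k + 1) x)
          (Function.update b (k + 1) y) = chainWeight F q L k a b := fun x y =>
        chainWeight_congr (fun i hi => Function.update_of_ne (by omega) _ _)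
          (fun i hi => Function.update_of_ne (by omega) _ _)
      have hw' : ∀ x y, chainWeight F q L (k + 1) (Function.update a (k + 1) x)
          (Function.update b (k + 1) y) = chainWeight F q L k a b * _ := fun x y => by
        rw [chainWeight, Finset.prod_range_succ, ← chainWeight, hw,
          Function.update_of_ne (by omega), Function.update_of_ne (by omega)]
      by_cases hst : IsStraight F (2 * L k / q) (a k) (b k)
      · obtain ⟨u, v, huv⟩ := hsplit.1
        exact ⟨_, by positivity, u, v, huv, fun i => by rw [hw', if_pos hst]⟩
      · obtain ⟨u, v, huv⟩ := hsplit.2 hst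
        exact ⟨_, by positivity, u, v, huv, fun i => by rw [hw', if_neg hst]⟩
    set W := chainWeight F q L k a b with hWdef
    have : Nonempty (Fin N) := ⟨⟨0, hN⟩⟩
    have hchild : ∀ i, ∃ ν : ProbabilityMeasure (E d),
        (ν : Measure (E d)) (F '' Set.Icc (u i) (v i))ᶜ = 0 ∧ W * (N : ℝ≥0∞)⁻¹ * energy s ℓ ν ≤ _ :=
      fun i => by
        have := ih (k + 1) (by omega) _ _ (h.update (huv.1 i).1 (huv.1 i).2.1 (huv.1 i).2.2)
        rw [hW] at this
        simpa using this
    choose ν hν hνE using hchild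
    obtain ⟨ν', hsupp, hE⟩ := exists_mixture hs ℓ κ ν (fun i => F '' Set.Icc (u i) (v i)) hν (by
      rintro i j hij _ ⟨x, hx, rfl⟩ _ ⟨y, hy, rfl⟩
      exact huv.2 i j hij x hx y hy)
    refine ⟨ν', hsupp _ fun i => Set.image_mono
      (Set.Icc_subset_Icc (huv.1 i).1 (huv.1 i).2.1), ?_⟩
    have hN0 : (N : ℝ≥0∞) ≠ 0 := by exact_mod_cast hN.ne'
    have hNt : (N : ℝ≥0∞) ≠ ∞ := ENNReal.natCast_ne_top N
    rw [Fintype.card_fin] at hE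
    rw [Finset.sum_eq_sum_Ico_succ_bot (by omega), ← hLs, ← hκ]
    calc W * energy s ℓ ν'
        ≤ W * ((N : ℝ≥0∞)⁻¹ * ((N : ℝ≥0∞)⁻¹ * ∑ i, energy s ℓ (ν i))
            + ENNReal.ofReal κ ^ (-s)) := by gcongr
      _ = (N : ℝ≥0∞)⁻¹ * ∑ i, W * (N : ℝ≥0∞)⁻¹ * energy s ℓ (ν i)
            + W * ENNReal.ofReal κ ^ (-s) := by rw [← Finset.mul_sum]; ring
      _ ≤ (N : ℝ≥0∞)⁻¹ * ∑ _i : Fin N, _ + B k * ENNReal.ofReal κ ^ (-s) :=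
          add_le_add (mul_le_mul_right (Finset.sum_le_sum fun i _ => hνE i) _)
            (mul_le_mul_left (hB k (by omega) a b h) _)
      _ = _ := by
          rw [Finset.sum_const, Finset.card_univ, Fintype.card_fin, nsmul_eq_mul, ← mul_assoc,
            ENNReal.inv_mul_cancel hN0 hNt, one_mul]
          ring

end Chain

/-! ### Energy bounds for paths whose straight segments are sparse -/

/-- The scales `r γ^{-i}` with `γ = q ^ 4 + q`. -/
def scale (r : ℝ) (q i : ℕ) : ℝ := r / (q ^ 4 + q) ^ i

/-- The exponent `D` with `γ ^ (2 D) = q ^ 4 (q ^ 4 + q ^ 2)`. -/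
def roughDim (q : ℕ) : ℝ :=
  Real.log ((q : ℝ) ^ 4 * (q ^ 4 + q ^ 2)) / (2 * Real.log (q ^ 4 + q))

theorem scale_pos {r : ℝ} (hr : 0 < r) {q : ℕ} (hq : 3 ≤ q) (i : ℕ) : 0 < scale r q i := by
  have : (0 : ℝ) < q := by exact_mod_cast (by omega : 0 < q)
  unfold scale; positivity

theorem scale_succ (r : ℝ) {q : ℕ} (i : ℕ) :
    scale r q (i + 1) = scale r q i / (q ^ 4 + q) := by
  rw [scale, scale, pow_succ, div_div]

theorem one_lt_base {q : ℕ} (hq : 3 ≤ q) : (1 : ℝ) < q ^ 4 + q := by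
  have h : (3 : ℝ) ≤ q := by exact_mod_cast hq
  have : (0 : ℝ) ≤ (q : ℝ) ^ 4 := by positivity
  linarith

/-- The claim amounts to `(q ^ 4 + q) ^ 2 < q ^ 4 (q ^ 4 + q ^ 2)`, that is, `q ^ 4 - 2 q ^ 3 - 1 >
0`. -/
theorem one_lt_roughDim {q : ℕ} (hq : 3 ≤ q) : 1 < roughDim q := by
  have h : (3 : ℝ) ≤ q := by exact_mod_cast hq
  have hγ := one_lt_base hq
  rw [roughDim, one_lt_div (by have := Real.log_pos hγ; positivity)]
  rw [← Nat.cast_ofNat (R := ℝ) (n := 2), ← Real.log_pow]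
  refine Real.log_lt_log (by positivity) ?_
  have h1 : (0 : ℝ) < (q : ℝ) ^ 2 := by positivity
  have h2 : (0 : ℝ) < (q : ℝ) ^ 4 - 2 * q ^ 3 - 1 := by
    have : (1 : ℝ) < (q : ℝ) ^ 3 := one_lt_pow₀ (by linarith) (by norm_num)
    nlinarith [mul_nonneg (by linarith : (0 : ℝ) ≤ q - 3) (by positivity : (0 : ℝ) ≤ (q : ℝ) ^ 3)]
  nlinarith [mul_pos h1 h2]

theorem base_rpow_neg_roughDim_sq {q : ℕ} (hq : 3 ≤ q) :
    (((q : ℝ) ^ 4 + q) ^ (-roughDim q)) ^ 2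
      = ((q : ℝ) ^ 4)⁻¹ * ((q : ℝ) ^ 4 + q ^ 2)⁻¹ := by
  have h : (3 : ℝ) ≤ q := by exact_mod_cast hq
  have hγ := one_lt_base hq
  have hlog := Real.log_pos hγ
  rw [← Real.rpow_natCast, ← Real.rpow_mul (by linarith), Real.rpow_def_of_pos (by linarith),
    ← mul_inv]
  rw [show Real.log ((q : ℝ) ^ 4 + q) * (-roughDim q * (2 : ℕ))
    = -Real.log ((q : ℝ) ^ 4 * (q ^ 4 + q ^ 2)) by
      rw [roughDim]
      generalize Real.log ((q : ℝ) ^ 4 + q) = l at hlog ⊢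
      generalize Real.log ((q : ℝ) ^ 4 * (q ^ 4 + q ^ 2)) = m
      push_cast
      field_simp,
    Real.exp_neg, Real.exp_log (by positivity)]

section Sparse

variable {d : ℕ}

open Classical in
/-- The levels `i < k` at which the segment of the chain is straight. -/
def straightLevels (F : ℝ → E d) (q : ℕ) (L : ℕ → ℝ) (k : ℕ) (a b : ℕ → ℝ) : Finset ℕ :=
  (Finset.range k).filter fun i => IsStraight F (2 * L i / q) (a i) (b i)

/-- With at most half of the factors equal to the larger number `x`, the product is largest when
exactly half are, and then it is a power of the geometric mean `β`. Here `x` and `y` are the inverse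
branching numbers at straight and non-straight levels. -/
theorem pow_mul_pow_le_of_sq_eq {x y β : ℝ} (hy : 0 ≤ y) (hyx : y ≤ x) (hβ : 0 ≤ β)
    (h : β ^ 2 = x * y) {c k : ℕ} (hc : 2 * c ≤ k) : x ^ c * y ^ (k - c) ≤ β ^ k := by
  have hx := hy.trans hyx
  obtain ⟨e, rfl⟩ := Nat.exists_eq_add_of_le hc
  refine abs_le_of_sq_le_sq' ?_ (by positivity) |>.2
  rw [← pow_mul, mul_comm (2 * c + e) 2, pow_mul, h, mul_pow, mul_pow, ← pow_mul, ← pow_mul,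
    show (2 * c + e - c) * 2 = (2 * c + e) + e by omega, pow_add y, pow_add x,
    show c * 2 = 2 * c by omega]
  have : y ^ e ≤ x ^ e := pow_le_pow_left₀ hy hyx e
  calc x ^ (2 * c) * (y ^ (2 * c + e) * y ^ e)
      ≤ x ^ (2 * c) * (y ^ (2 * c + e) * x ^ e) := by gcongr
    _ = _ := by ring

theorem chainWeight_le_one {F : ℝ → E d} {q : ℕ} (hq : 3 ≤ q) {L : ℕ → ℝ} {k : ℕ} {a b : ℕ → ℝ} :
    chainWeight F q L k a b ≤ 1 := by
  refine Finset.prod_le_one' fun i _ => ?_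
  split_ifs <;>
  · rw [ENNReal.inv_le_one]
    exact_mod_cast Nat.succ_le_of_lt (by positivity)

theorem chainWeight_le_of_sparse {F : ℝ → E d} {q : ℕ} (hq : 3 ≤ q) {L : ℕ → ℝ} {k : ℕ}
    {a b : ℕ → ℝ} (h : 2 * (straightLevels F q L k a b).card ≤ k) :
    chainWeight F q L k a b ≤ ENNReal.ofReal ((((q : ℝ) ^ 4 + q) ^ (-roughDim q)) ^ k) := by
  have hq0 : (0 : ℝ) < q := by exact_mod_cast (by omega : 0 < q)
  classical
  have e1 : ∀ N : ℕ, 0 < N → (N : ℝ≥0∞)⁻¹ = ENNReal.ofReal ((N : ℝ)⁻¹) := fun N hN => by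
    rw [ENNReal.ofReal_inv_of_pos (by exact_mod_cast hN), ENNReal.ofReal_natCast]
  have hcard : (Finset.filter (fun i => ¬ IsStraight F (2 * L i / q) (a i) (b i))
      (Finset.range k)).card = k - (straightLevels F q L k a b).card := by
    have := Finset.card_filter_add_card_filter_not (s := Finset.range k)
      (fun i => IsStraight F (2 * L i / q) (a i) (b i))
    rw [Finset.card_range] at this
    unfold straightLevels
    convert (Nat.eq_sub_of_add_eq' this) using 2
  rw [chainWeight, Finset.prod_ite, Finset.prod_const, Finset.prod_const, hcard,
    e1 _ (by positivity), e1 _ (by positivity), ← ENNReal.ofReal_pow (by positivity),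
    ← ENNReal.ofReal_pow (by positivity), ← ENNReal.ofReal_mul (by positivity)]
  refine ENNReal.ofReal_le_ofReal ?_
  push_cast
  refine le_trans (le_of_eq ?_) (pow_mul_pow_le_of_sq_eq (by positivity)
    (inv_anti₀ (by positivity) (le_add_of_nonneg_right (by positivity))) (by positivity)
    (base_rpow_neg_roughDim_sq hq) h)
  simp only [straightLevels]

/-- Sparsity makes the weight at depth `k` at most a constant times `γ ^ (-k D)`, `D = roughDim q`,
while level `k` contributes `κ ^ (-s)` of order `γ ^ (k s)`. The sum is geometric as `s < D`. The
bound `u` is chosen before the path, the cutoff `δ` and the depth `n`. -/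
theorem exists_energy_le {q : ℕ} (hq : 3 ≤ q) {s : ℝ} (hs : 0 < s) (hsd : s < roughDim q) {r A : ℝ}
    (hr : 0 < r) (hA : 0 < A) (k₀ : ℕ) :
    ∃ u : ℝ≥0, ∀ F : ℝ → E d, Continuous F → ∀ δ : ℝ, 0 < δ → ∀ n : ℕ, scale r q n < A * δ →
      (∀ k, k₀ ≤ k → k ≤ n → ∀ a b, IsChain F (scale r q) k a b →
        2 * (straightLevels F q (scale r q) k a b).card ≤ k) →
      ∀ a b : ℝ, 0 ≤ a → a ≤ b → b ≤ 1 → r ≤ dist (F a) (F b) →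
        ∃ ν : ProbabilityMeasure (E d), (ν : Measure (E d)) (F '' Set.Icc 0 1)ᶜ = 0 ∧
          energy s δ ν ≤ u := by
  have hq0 : (3 : ℝ) ≤ q := by exact_mod_cast hq
  have hγ := one_lt_base hq
  set γ : ℝ := (q : ℝ) ^ 4 + q with hγdef
  have hγ0 : 0 < γ := by linarith
  set β : ℝ := γ ^ (-roughDim q) with hβ
  have hβ0 : 0 < β := Real.rpow_pos_of_pos hγ0 _
  have hβ1 : β ≤ 1 := Real.rpow_le_one_of_one_le_of_nonpos hγ.le
    (by linarith [one_lt_roughDim hq])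
  set x : ℝ := β * γ ^ s with hx
  have hx0 : 0 < x := by positivity
  have hx1 : x < 1 := by
    rw [hx, hβ, ← Real.rpow_add hγ0]
    exact Real.rpow_lt_one_of_one_lt_of_neg hγ (by linarith)
  set c : ℝ := 1 / q ^ 4 - 1 / γ with hc
  have hc0 : 0 < c := by
    rw [hc, sub_pos]
    apply one_div_lt_one_div_of_lt (by positivity); linarith
  -- This factor absorbs the levels below `k₀`, where sparsity is not available and the weight is
  -- only known to be at most one.
  set b₀ : ℝ := (β⁻¹) ^ k₀ with hb₀
  have hb₀0 : 0 < b₀ := by positivity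
  set U : ℝ := b₀ * (c * r) ^ (-s) * (1 - x)⁻¹ + b₀ * (r / A) ^ (-s) with hU
  have hpow : ∀ (C : ℝ), 0 < C → ∀ i : ℕ, (C * (r / γ ^ i)) ^ (-s) = (C * r) ^ (-s) * (γ ^ s) ^ i := by
    intro C hC i
    rw [← mul_div_assoc, Real.div_rpow (by positivity) (by positivity), ← Real.rpow_natCast,
      ← Real.rpow_mul hγ0.le, div_eq_mul_inv, ← Real.rpow_neg hγ0.le, ← Real.rpow_natCast,
      ← Real.rpow_mul hγ0.le]
    congr 2
    ring
  refine ⟨U.toNNReal, fun F hF δ hδ n hn hsparse a b ha hab hb hrab => ?_⟩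
  obtain ⟨v, hv, hseg⟩ := exists_isSegment hF hab hr.le hrab
  let B : ℕ → ℝ≥0∞ := fun k => ENNReal.ofReal (β ^ k * b₀)
  have hB : ∀ k ≤ n, ∀ a b, IsChain F (scale r q) k a b →
      chainWeight F q (scale r q) k a b ≤ B k := by
    intro k hk a b h
    by_cases hk0 : k₀ ≤ k
    · refine (chainWeight_le_of_sparse hq (hsparse k hk0 hk a b h)).trans
        (ENNReal.ofReal_le_ofReal ?_)
      exact le_mul_of_one_le_right (by positivity) (one_le_pow₀ ((one_le_inv₀ hβ0).2 hβ1))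
    · refine (chainWeight_le_one hq).trans ?_
      rw [← ENNReal.ofReal_one]
      refine ENNReal.ofReal_le_ofReal ?_
      rw [hb₀, inv_pow, ← div_eq_mul_inv, one_le_div (by positivity)]
      exact pow_le_pow_of_le_one hβ0.le hβ1 (by omega)
  have hchain : IsChain F (scale r q) 0 (fun _ => a) (fun _ => v) := by
    refine ⟨ha, hv.2.trans hb, fun i hi => ?_, fun i hi => by omega⟩
    obtain rfl : i = 0 := by omega
    simpa [scale] using hseg
  obtain ⟨ν, hν, hE⟩ := exists_measure_chainWeight_mul_energy_le hF hq hs.le δ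
    (scale_pos hr hq) (scale_succ r) hB n 0 (by omega) _ _ hchain
  refine ⟨ν, measure_mono_null (Set.compl_subset_compl.2 (Set.image_mono
    (Set.Icc_subset_Icc ha (hv.2.trans hb)))) hν, ?_⟩
  have hW : chainWeight F q (scale r q) 0 (fun _ => a) (fun _ => v) = 1 := by simp [chainWeight]
  rw [hW, one_mul] at hE
  refine hE.trans ?_
  have hterm : ∀ i, B i * ENNReal.ofReal (scale r q i / q ^ 4 - scale r q i / (q ^ 4 + q)) ^ (-s)
      = ENNReal.ofReal (b₀ * (c * r) ^ (-s) * x ^ i) := by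
    intro i
    have e : scale r q i / q ^ 4 - scale r q i / (q ^ 4 + q) = c * (r / γ ^ i) := by
      rw [scale, ← hγdef, hc]; ring
    rw [e, ENNReal.ofReal_rpow_of_pos (by positivity), hpow c hc0,
      ← ENNReal.ofReal_mul (by positivity)]
    congr 1
    rw [hx, mul_pow]; ring
  -- The last scale is below `A δ`, hence `δ ^ (-s)` is at most a constant times `γ ^ (n s)`, which
  -- the weight `β ^ n` compensates.
  have hlast : B n * ENNReal.ofReal δ ^ (-s) ≤ ENNReal.ofReal (b₀ * (r / A) ^ (-s)) := by
    rw [ENNReal.ofReal_rpow_of_pos hδ, ← ENNReal.ofReal_mul (by positivity)]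
    refine ENNReal.ofReal_le_ofReal ?_
    have h1 : A⁻¹ * (r / γ ^ n) ≤ δ := by
      rw [inv_mul_le_iff₀ hA]; exact hn.le
    have h2 : δ ^ (-s) ≤ (A⁻¹ * (r / γ ^ n)) ^ (-s) :=
      Real.rpow_le_rpow_of_nonpos (by positivity) h1 (by linarith)
    rw [hpow _ (by positivity), inv_mul_eq_div] at h2
    calc β ^ n * b₀ * δ ^ (-s) ≤ β ^ n * b₀ * ((r / A) ^ (-s) * (γ ^ s) ^ n) := by gcongr
      _ = b₀ * (r / A) ^ (-s) * x ^ n := by rw [hx, mul_pow]; ring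
      _ ≤ b₀ * (r / A) ^ (-s) * 1 := by gcongr; exact pow_le_one₀ hx0.le hx1.le
      _ = _ := mul_one _
  calc _ ≤ ENNReal.ofReal (b₀ * (c * r) ^ (-s) * (1 - x)⁻¹)
        + ENNReal.ofReal (b₀ * (r / A) ^ (-s)) := by
        refine add_le_add ?_ hlast
        simp only [hterm]
        rw [← ENNReal.ofReal_sum_of_nonneg fun i _ => by positivity, ← Finset.mul_sum]
        refine ENNReal.ofReal_le_ofReal (mul_le_mul_of_nonneg_left ?_ (by positivity))
        rw [← tsum_geometric_of_lt_one hx0.le hx1]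
        exact (summable_geometric_of_lt_one hx0.le hx1).sum_le_tsum _ fun i _ => by positivity
    _ = (U.toNNReal : ℝ≥0∞) := by
        have : 0 < 1 - x := by linarith
        rw [← ENNReal.ofReal_add (by positivity) (by positivity)]; rfl

end Sparse

/-! ### Cylinders along a given axis -/

section Axis

variable {d : ℕ}

/-- The cylinder of radius `w` around the axis from `x + h e` to `x + (h + l) e`. -/
def axisCylinder (x e : E d) (h l w : ℝ) (he : ‖e‖ = 1) (hl : 0 < l) (hw : 0 < w) :
    Cylinder d where
  base := x + h • e
  top := x + (h + l) • e
  radius := w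
  base_ne_top := by
    intro hbt
    have : l • e = 0 := by
      rw [add_smul, ← add_assoc] at hbt
      simpa using hbt
    rcases smul_eq_zero.1 this with h' | h'
    · exact hl.ne' h'
    · simp [h'] at he
  radius_pos := hw

variable {x e : E d} {h l w : ℝ} {he : ‖e‖ = 1} {hl : 0 < l} {hw : 0 < w}

theorem axisCylinder_top_sub_base :
    (axisCylinder x e h l w he hl hw).top - (axisCylinder x e h l w he hl hw).base = l • e := by
  simp only [axisCylinder, add_smul]; abel

theorem axisCylinder_length : (axisCylinder x e h l w he hl hw).length = l := by
  rw [Cylinder.length, dist_comm, dist_eq_norm, axisCylinder_top_sub_base, norm_smul, he,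
    Real.norm_of_nonneg hl.le, mul_one]

theorem mem_axisCylinder_slice {z : E d} {t : ℝ} :
    z ∈ (axisCylinder x e h l w he hl hw).slice t ↔
      ∃ v : E d, inner ℝ v e = 0 ∧ ‖v‖ ≤ w ∧ z = x + (h + t * l) • e + v := by
  simp only [Cylinder.slice, Set.mem_ofPred_eq, axisCylinder_top_sub_base, real_inner_smul_right,
    mul_eq_zero, hl.ne', false_or]
  refine exists_congr fun v => and_congr_right fun _ => and_congr_right fun _ => ?_
  rw [show (axisCylinder x e h l w he hl hw).base = x + h • e from rfl, smul_smul, add_smul,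
    add_assoc x]

theorem mem_axisCylinder_carrier {z : E d} :
    z ∈ (axisCylinder x e h l w he hl hw).carrier ↔
      ∃ c ∈ Set.Icc h (h + l), ∃ v : E d, inner ℝ v e = 0 ∧ ‖v‖ ≤ w ∧ z = x + c • e + v := by
  simp only [Cylinder.carrier, Set.mem_iUnion, mem_axisCylinder_slice, exists_prop]
  constructor
  · rintro ⟨t, ht, hv⟩
    exact ⟨h + t * l, ⟨by nlinarith [ht.1], by nlinarith [ht.2]⟩, hv⟩
  · rintro ⟨c, hc, hv⟩
    refine ⟨(c - h) / l, ⟨div_nonneg (by linarith [hc.1]) hl.le,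
      (div_le_one hl).2 (by linarith [hc.2])⟩, ?_⟩
    rwa [div_mul_cancel₀ _ hl.ne', add_sub_cancel]

theorem inner_axis {c : ℝ} {v : E d} (he : ‖e‖ = 1) (hv : inner ℝ v e = 0) :
    inner ℝ (x + c • e + v - x) e = c := by
  rw [show x + c • e + v - x = c • e + v by abel, inner_add_left, hv, real_inner_smul_left,
    real_inner_self_eq_norm_sq, he]
  ring

theorem abs_inner_le_of_norm_eq_one {u e : E d} (he : ‖e‖ = 1) : |inner ℝ u e| ≤ ‖u‖ := by
  simpa [he] using abs_real_inner_le_norm u e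

theorem ediam_axisCylinder_le :
    Metric.ediam (axisCylinder x e h l w he hl hw).carrier ≤ ENNReal.ofReal (l + 2 * w) := by
  refine Metric.ediam_le fun z hz z' hz' => ?_
  obtain ⟨c, hc, v, -, hv, rfl⟩ := mem_axisCylinder_carrier.1 hz
  obtain ⟨c', hc', v', -, hv', rfl⟩ := mem_axisCylinder_carrier.1 hz'
  rw [edist_dist, dist_eq_norm]
  refine ENNReal.ofReal_le_ofReal ?_
  rw [show x + c • e + v - (x + c' • e + v') = (c - c') • e + (v - v') by rw [sub_smul]; abel]
  have h1 : ‖(c - c') • e‖ ≤ l := by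
    rw [norm_smul, he, mul_one, Real.norm_eq_abs, abs_le]
    constructor <;> linarith [hc.1, hc.2, hc'.1, hc'.2]
  linarith [norm_add_le ((c - c') • e) (v - v'), norm_sub_le v v']

theorem norm_orthogonal_part_le {z : E d} (he : ‖e‖ = 1) (c : ℝ) :
    inner ℝ (z - x - (inner ℝ (z - x) e : ℝ) • e) e = 0 ∧
      ‖z - x - (inner ℝ (z - x) e : ℝ) • e‖ ≤ ‖z - (x + c • e)‖ := by
  have h0 : inner ℝ (z - x - (inner ℝ (z - x) e : ℝ) • e) e = 0 := by
    rw [inner_sub_left, real_inner_smul_left, real_inner_self_eq_norm_sq, he]; ring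
  refine ⟨h0, abs_le_of_sq_le_sq' ?_ (norm_nonneg _) |>.2⟩
  rw [show z - (x + c • e) = (inner ℝ (z - x) e - c : ℝ) • e
    + (z - x - (inner ℝ (z - x) e : ℝ) • e) by rw [sub_smul]; abel,
    norm_sq_smul_add_of_inner_eq_zero h0]
  nlinarith [mul_nonneg (sq_nonneg (inner ℝ (z - x) e - c : ℝ)) (sq_nonneg ‖e‖)]

/-- A path that stays in the tube around the axis and passes from below to above the cylinder
crosses it. -/
theorem exists_crossing_axisCylinder {F : ℝ → E d} (hF : Continuous F) {a b : ℝ} (hab : a ≤ b)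
    (htube : ∀ t ∈ Set.Icc a b, ∃ c : ℝ, ‖F t - (x + c • e)‖ ≤ w)
    (ha : inner ℝ (F a - x) e ≤ h) (hb : h + l ≤ inner ℝ (F b - x) e) :
    ∃ s u, a ≤ s ∧ s ≤ u ∧ u ≤ b ∧ F s ∈ (axisCylinder x e h l w he hl hw).slice 0 ∧
      F u ∈ (axisCylinder x e h l w he hl hw).slice 1 ∧
      ∀ t ∈ Set.Icc s u, F t ∈ (axisCylinder x e h l w he hl hw).carrier := by
  obtain ⟨s, u, has, hsu, hub, hs, hu, hsu'⟩ := exists_crossing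
    (g := fun t => (inner ℝ (F t - x) e : ℝ)) (by fun_prop) hab ha (by linarith) hb
  have key : ∀ t ∈ Set.Icc s u, ∃ v : E d, inner ℝ v e = 0 ∧ ‖v‖ ≤ w ∧
      F t = x + (inner ℝ (F t - x) e : ℝ) • e + v := by
    intro t ht
    obtain ⟨c, hc⟩ := htube t ⟨has.trans ht.1, ht.2.trans hub⟩
    obtain ⟨h1, h2⟩ := norm_orthogonal_part_le (x := x) (z := F t) he c
    exact ⟨_, h1, h2.trans hc, by abel⟩
  refine ⟨s, u, has, hsu, hub, ?_, ?_, ?_⟩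
  · rw [mem_axisCylinder_slice, zero_mul, add_zero, ← hs]
    exact key s ⟨le_rfl, hsu⟩
  · rw [mem_axisCylinder_slice, one_mul, ← hu]
    exact key u ⟨hsu, le_rfl⟩
  · intro t ht
    rw [mem_axisCylinder_carrier]
    exact ⟨_, hsu' t ht, key t ht⟩

end Axis

/-! ### Straight segments cross thin cylinders -/

namespace ParamCurve

variable {d : ℕ} {Λ : Set (E d)}

/-- The parametrized curve, extended to a path over the real line. -/
def path (f : ParamCurve Λ) (t : ℝ) : E d := f.eval (Set.projIcc 0 1 zero_le_one t)

theorem continuous_path (f : ParamCurve Λ) : Continuous f.path :=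
  f.continuous_eval.comp continuous_projIcc

theorem path_coe (f : ParamCurve Λ) (t : I) : f.path t = f.eval t := by
  rw [path, Set.projIcc_val]

end ParamCurve

section Tube

variable {d : ℕ}

theorem norm_le_lineDist_of_inner_eq_zero {V : Type*} [NormedAddCommGroup V]
    [InnerProductSpace ℝ V] {x y z w : V} {c : ℝ} (hz : z - x = c • (y - x) + w)
    (hw : inner ℝ w (y - x) = 0) : ‖w‖ ≤ lineDist x y z := by
  rw [lineDist, Metric.le_infDist (Set.range_nonempty _)]
  rintro _ ⟨c', rfl⟩
  rw [dist_eq_norm]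
  refine abs_le_of_sq_le_sq' ?_ (norm_nonneg _) |>.2
  rw [show z - (x + c' • (y - x)) = (c - c') • (y - x) + w by
    rw [← sub_sub, hz, sub_smul]; abel, norm_sq_smul_add_of_inner_eq_zero hw]
  nlinarith [mul_nonneg (sq_nonneg (c - c')) (sq_nonneg ‖y - x‖)]

/-- Straightness survives replacing the end points by nearby `x` and `y`. The coordinate `c` along
the axis satisfies `|c| ≤ 1` because a segment stays within `L` of its start, so the axis moves by
at most `|1 - c| τ + |c| τ ≤ 3 τ`. -/
theorem exists_norm_sub_le_of_isStraight {F : ℝ → E d} {L a b w τ : ℝ} (hL : 0 < L)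
    (hseg : IsSegment F L a b) (hst : IsStraight F w a b) {x y : E d} (hx : dist (F a) x ≤ τ)
    (hy : dist (F b) y ≤ τ) {t : ℝ} (ht : t ∈ Set.Icc a b) :
    ∃ c : ℝ, ‖F t - (x + c • (L⁻¹ • (y - x)))‖ ≤ w + 3 * τ := by
  obtain ⟨c, v, hz, hv⟩ := exists_orthogonal_decomposition (F b - F a) (F t - F a)
  have h1 := (norm_le_lineDist_of_inner_eq_zero hz hv).trans (hst t ht)
  have h2 : |c| ≤ 1 := by
    have e := norm_sq_smul_add_of_inner_eq_zero hv c
    have h3 := hseg.dist_le t ht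
    rw [dist_comm, dist_eq_norm] at h3
    have h4 := hseg.dist_eq
    rw [dist_comm, dist_eq_norm] at h4
    rw [← hz, h4] at e
    have h5 : ‖F t - F a‖ ^ 2 ≤ L ^ 2 := pow_le_pow_left₀ (norm_nonneg _) h3 2
    have h6 : c ^ 2 * L ^ 2 ≤ 1 * L ^ 2 := by nlinarith [sq_nonneg ‖v‖]
    have h7 := le_of_mul_le_mul_right h6 (by positivity)
    exact abs_le_one_iff_mul_self_le_one.2 (by nlinarith)
  rw [dist_eq_norm] at hx hy
  refine ⟨c * L, ?_⟩
  rw [smul_smul, mul_assoc, mul_inv_cancel₀ hL.ne', mul_one,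
    show F t - (x + c • (y - x)) = v + (1 - c) • (F a - x) + c • (F b - y) by
      rw [show F t - (x + c • (y - x)) = (F t - F a) + F a - (x + c • (y - x)) by abel, hz]
      module]
  have h3 : ‖(1 - c) • (F a - x)‖ ≤ 2 * τ := by
    rw [norm_smul]
    refine mul_le_mul ?_ hx (norm_nonneg _) (by norm_num)
    rw [Real.norm_eq_abs, abs_le]
    constructor <;> linarith [(abs_le.1 h2).1, (abs_le.1 h2).2]
  have h4 : ‖c • (F b - y)‖ ≤ 1 * τ := by
    rw [norm_smul]
    exact mul_le_mul h2 hy (norm_nonneg _) (by norm_num)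
  linarith [norm_add₃_le (a := v) (b := (1 - c) • (F a - x)) (c := c • (F b - y))]

theorem traverses_axisCylinder {Λ : Set (E d)} {C : Curve Λ} {f : ParamCurve Λ} (hf : C.IsParam f)
    {L a b w τ : ℝ} (hL : 0 < L) (ha0 : 0 ≤ a) (hb1 : b ≤ 1) (hseg : IsSegment f.path L a b)
    (hst : IsStraight f.path w a b) {x y : E d} (hxy : dist x y = L)
    (hx : dist (f.path a) x ≤ τ) (hy : dist (f.path b) y ≤ τ) {h l : ℝ}
    (he : ‖L⁻¹ • (y - x)‖ = 1) (hl : 0 < l) (hw : 0 < w + 3 * τ) (hτ : τ ≤ h)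
    (hτ' : h + l ≤ L - τ) :
    C.Traverses (axisCylinder x (L⁻¹ • (y - x)) h l (w + 3 * τ) he hl hw) := by
  have h1 : inner ℝ (f.path a - x) (L⁻¹ • (y - x)) ≤ h := by
    rw [dist_eq_norm] at hx
    exact (le_abs_self _).trans ((abs_inner_le_of_norm_eq_one he).trans (hx.trans hτ))
  have h2 : h + l ≤ inner ℝ (f.path b - x) (L⁻¹ • (y - x)) := by
    rw [dist_eq_norm] at hy
    have e : inner ℝ (y - x) (L⁻¹ • (y - x)) = L := by
      rw [real_inner_smul_right, real_inner_self_eq_norm_sq, ← dist_eq_norm, dist_comm, hxy]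
      field_simp
    rw [show f.path b - x = (f.path b - y) + (y - x) by abel, inner_add_left, e]
    have := neg_abs_le (inner ℝ (f.path b - y) (L⁻¹ • (y - x)))
    have := abs_inner_le_of_norm_eq_one (u := f.path b - y) he
    linarith
  obtain ⟨s, u, has, hsu, hub, hs, hu, hc⟩ := exists_crossing_axisCylinder (he := he) (hl := hl)
    (hw := hw) f.continuous_path hseg.le
    (fun t ht => exists_norm_sub_le_of_isStraight hL hseg hst hx hy ht) h1 h2
  have hs0 : 0 ≤ s := ha0.trans has
  have hu1 : u ≤ 1 := hub.trans hb1
  refine ⟨f, hf, ⟨s, hs0, hsu.trans hu1⟩, ⟨u, hs0.trans hsu, hu1⟩, hsu, ?_, ?_, ?_⟩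
  · rw [← f.path_coe]; exact hs
  · rw [← f.path_coe]; exact hu
  · intro t ht
    rw [← f.path_coe]
    exact hc t ⟨ht.1, ht.2⟩

end Tube

/-! ### Well separated cylinders along a chain -/

section Family

variable {d : ℕ}

theorem IsChain.Icc_subset {X : Type*} [MetricSpace X] {F : ℝ → X} {L : ℕ → ℝ} {k : ℕ}
    {a b : ℕ → ℝ} (h : IsChain F L k a b) {i j : ℕ} (hij : i ≤ j) (hj : j ≤ k) :
    a i ≤ a j ∧ b j ≤ b i := by
  induction j, hij using Nat.le_induction with
  | base => exact ⟨le_rfl, le_rfl⟩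
  | succ j hij ih =>
    have h1 := ih (by omega)
    have h2 := h.nested j (by omega)
    exact ⟨h1.1.trans h2.1, h2.2.trans h1.2⟩

theorem IsChain.dist_le {X : Type*} [MetricSpace X] {F : ℝ → X} {L : ℕ → ℝ} {k : ℕ}
    {a b : ℕ → ℝ} (h : IsChain F L k a b) {i j : ℕ} (hij : i ≤ j) (hj : j ≤ k) :
    dist (F (a i)) (F (a j)) ≤ L i := by
  have h1 := h.Icc_subset hij hj
  exact (h.seg i (by omega)).dist_le _ ⟨h1.1, (h.seg j hj).le.trans h1.2⟩

theorem scale_anti {r : ℝ} (hr : 0 < r) {q : ℕ} (hq : 3 ≤ q) {i j : ℕ} (hij : i ≤ j) :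
    scale r q j ≤ scale r q i :=
  div_le_div_of_nonneg_left hr.le (by have := one_lt_base hq; positivity)
    (pow_le_pow_right₀ (one_lt_base hq).le hij)

/-- The cylinders depend only on the reference chain, and every curve with a chain close to it,
straight at the levels in `J`, crosses all of them. Thus one family serves a whole class of chains.
Separation between levels comes from using, at each level, the half of the axis that the rest of the
chain avoids. -/
theorem exists_cylinder_family {F : ℝ → E d} {r σ : ℝ} {q P k : ℕ} (hr : 0 < r) (hq : 3 ≤ q)
    (hσ : 0 < σ) (hσq : σ ≤ q)
    (hP : ((P : ℝ) + 1) * (6 * (2 + σ) / (q * σ)) + 1 / (3 * q) ≤ 1 / 2) {a b : ℕ → ℝ}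
    (hc : IsChain F (scale r q) k a b) {J : Finset ℕ} (hJ : J ⊆ Finset.range k) :
    ∃ A : J × Fin P → Cylinder d, WellSeparated (fun p => (A p).carrier) ∧
      (∀ p, (A p).width = σ * (A p).length) ∧
      (∀ p, (A p).length = 6 * scale r q p.1 / (q * σ)) ∧
      ∀ (Λ : Set (E d)) (C : Curve Λ) (f : ParamCurve Λ), C.IsParam f → ∀ a' b' : ℕ → ℝ,
        IsChain f.path (scale r q) k a' b' →
        (∀ i ∈ J, IsStraight f.path (2 * scale r q i / q) (a' i) (b' i)) →
        (∀ i ∈ J, dist (f.path (a' i)) (F (a i)) ≤ scale r q i / (3 * q)) →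
        (∀ i ∈ J, dist (f.path (b' i)) (F (b i)) ≤ scale r q i / (3 * q)) →
        ∀ p, C.Traverses (A p) := by
  have hq0 : (3 : ℝ) ≤ q := by exact_mod_cast hq
  have hqp : (0 : ℝ) < q := by linarith
  set L : ℕ → ℝ := scale r q with hLdef
  have hL : ∀ i, 0 < L i := scale_pos hr hq
  have hJk : ∀ i : J, (i : ℕ) < k := fun i => Finset.mem_range.1 (hJ i.2)
  -- The tube radius is `2 L / q` plus `3 τ` with `τ = L / (3 q)`, so the width is `6 L / q`, and
  -- the aspect ratio `σ` dictates this length.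
  set l : ℕ → ℝ := fun i => 6 * L i / (q * σ) with hl
  have hl0 : ∀ i, 0 < l i := fun i => by have := hL i; simp only [hl]; positivity
  have hlσ : ∀ i, l i * σ = 6 * L i / q := fun i => by simp only [hl]; field_simp
  set e : ℕ → E d := fun i => (L i)⁻¹ • (F (b i) - F (a i)) with he
  have he1 : ∀ i : J, ‖e i‖ = 1 := fun i => by
    simp only [he]
    rw [norm_smul, ← dist_eq_norm, dist_comm, (hc.seg i (hJk i).le).dist_eq, norm_inv,
      Real.norm_of_nonneg (hL i).le, inv_mul_cancel₀ (hL i).ne']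
  -- The spacing is one length plus the diameter bound `l (1 + σ)`.
  set Δ : ℕ → ℝ := fun i => l i * (2 + σ) with hΔ
  have hΔ0 : ∀ i, 0 < Δ i := fun i => by have := hl0 i; simp only [hΔ]; positivity
  have hlΔ : ∀ i, l i ≤ Δ i := fun i => by
    simp only [hΔ]; nlinarith [hl0 i, mul_pos (hl0 i) hσ]
  have hPi : ∀ i, ((P : ℝ) + 1) * Δ i + L i / (3 * q) ≤ L i / 2 := fun i => by
    have := mul_le_mul_of_nonneg_right hP (hL i).le
    calc ((P : ℝ) + 1) * Δ i + L i / (3 * q)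
        = (((P : ℝ) + 1) * (6 * (2 + σ) / (q * σ)) + 1 / (3 * q)) * L i := by
          simp only [hΔ, hl]; ring
      _ ≤ 1 / 2 * L i := this
      _ = L i / 2 := by ring
  set H : ℕ → ℝ := fun i => inner ℝ (F (a (i + 1)) - F (a i)) (e i) with hH
  -- `H` is the height at which the next segment starts. The cylinders go into the half of the axis
  -- that does not contain it, with a margin `Δ` from `H`; `hP` guarantees the room.
  set o : ℕ → ℝ := fun i => if L i / 2 ≤ H i then L i / (3 * q) else L i / 2 + Δ i with ho
  have hjP : ∀ (i : ℕ) (j : Fin P), 0 ≤ ((j : ℕ) : ℝ) * Δ i ∧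
      (((j : ℕ) : ℝ) + 1) * Δ i ≤ P * Δ i := fun i j => by
    have h1 : ((j : ℕ) : ℝ) + 1 ≤ P := by exact_mod_cast j.2
    exact ⟨mul_nonneg (by positivity) (hΔ0 i).le, mul_le_mul_of_nonneg_right h1 (hΔ0 i).le⟩
  have hlow : ∀ (i : ℕ) (j : Fin P), L i / (3 * q) ≤ o i + j * Δ i := fun i j => by
    have h1 := (hjP i j).1
    have h2 := hPi i
    have h3 : 0 ≤ ((P : ℝ) + 1) * Δ i := mul_nonneg (by positivity) (hΔ0 i).le
    have h4 := hΔ0 i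
    simp only [ho]
    split_ifs <;> linarith
  have hhigh : ∀ (i : ℕ) (j : Fin P), o i + j * Δ i + l i ≤ L i - L i / (3 * q) := fun i j => by
    have h1 := (hjP i j).2
    have h2 := hPi i
    have h3 := hlΔ i
    have h4 := hL i
    have h5 := hΔ0 i
    have h6 : 0 ≤ L i / (3 * q) := by positivity
    have h7 : 0 ≤ ((P : ℝ) + 1) * Δ i := mul_nonneg (by positivity) h5.le
    simp only [ho]
    split_ifs <;> linarith
  have hgap : ∀ (i : ℕ) (j : Fin P), ∀ c ∈ Set.Icc (o i + j * Δ i) (o i + j * Δ i + l i),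
      Δ i ≤ |c - H i| := fun i j c hc => by
    have h1 := hjP i j
    have h2 := hPi i
    have h3 := hlΔ i
    obtain ⟨h5, h6⟩ := hc
    simp only [ho] at h5 h6
    by_cases hcase : L i / 2 ≤ H i
    · rw [if_pos hcase] at h5 h6
      rw [abs_sub_comm]
      refine le_trans ?_ (le_abs_self _)
      linarith
    · rw [if_neg hcase] at h5 h6
      push Not at hcase
      refine le_trans ?_ (le_abs_self _)
      linarith
  have hw0 : ∀ i, 0 < 2 * L i / q + 3 * (L i / (3 * q)) := fun i => by
    have := hL i; positivity
  have hw : ∀ i, 2 * (2 * L i / q + 3 * (L i / (3 * q))) = l i * σ := fun i => by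
    rw [hlσ]; field_simp; ring
  let A : J × Fin P → Cylinder d := fun p => axisCylinder (F (a p.1)) (e p.1)
    (o p.1 + p.2 * Δ p.1) (l p.1) (2 * L p.1 / q + 3 * (L p.1 / (3 * q))) (he1 p.1) (hl0 p.1)
    (hw0 p.1)
  have hdiam : ∀ p, Metric.ediam (A p).carrier ≤ ENNReal.ofReal (l p.1 * (1 + σ)) := fun p => by
    refine ediam_axisCylinder_le.trans_eq ?_
    rw [hw]; congr 1; ring
  have hheight : ∀ p, ∀ z ∈ (A p).carrier, inner ℝ (z - F (a p.1)) (e p.1)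
      ∈ Set.Icc (o p.1 + p.2 * Δ p.1) (o p.1 + p.2 * Δ p.1 + l p.1) := by
    intro p z hz
    obtain ⟨c, hc, v, hv, -, rfl⟩ := mem_axisCylinder_carrier.1 hz
    rw [inner_axis (he1 p.1) hv]
    exact hc
  have hnear : ∀ p, ∀ z ∈ (A p).carrier, dist z (F (a p.1)) ≤ 2 * L p.1 := by
    intro p z hz
    obtain ⟨c, hc, v, hv, hvw, rfl⟩ := mem_axisCylinder_carrier.1 hz
    have h1 := hlow p.1 p.2
    have h2 := hhigh p.1 p.2
    have h0 : 0 ≤ L p.1 / (3 * q) := by have := hL p.1; positivity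
    have h3 : ‖c • e p.1‖ ≤ L p.1 := by
      rw [norm_smul, he1, mul_one, Real.norm_eq_abs, abs_le]
      have := hL p.1
      constructor <;> linarith [hc.1, hc.2]
    have h4 : ‖v‖ ≤ L p.1 := by
      refine hvw.trans ?_
      rw [show 2 * L p.1 / q + 3 * (L p.1 / (3 * q)) = L p.1 * (3 / q) by field_simp; ring]
      exact mul_le_of_le_one_right (hL p.1).le ((div_le_one hqp).2 hq0)
    rw [dist_eq_norm, show F (a p.1) + c • e p.1 + v - F (a p.1) = c • e p.1 + v by abel]
    linarith [norm_add_le (c • e p.1) v]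
  -- cylinders at the same level
  have hsame : ∀ (i : J) (j j' : Fin P), j ≠ j' → ∀ z ∈ (A (i, j)).carrier,
      ∀ z' ∈ (A (i, j')).carrier, l i * (1 + σ) ≤ dist z z' := by
    have key : ∀ (i : J) (j j' : Fin P), j < j' → ∀ z ∈ (A (i, j)).carrier,
        ∀ z' ∈ (A (i, j')).carrier, l i * (1 + σ) ≤ dist z z' := by
      intro i j j' hjj z hz z' hz'
      have h1 := (hheight _ z hz).2
      have h2 := (hheight _ z' hz').1
      have h3 : ((j : ℕ) : ℝ) + 1 ≤ (j' : ℕ) := by exact_mod_cast hjj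
      have h4 := mul_le_mul_of_nonneg_right h3 (hΔ0 i).le
      have h5 := (le_abs_self _).trans (abs_inner_le_of_norm_eq_one (u := z' - z) (he1 i))
      rw [show z' - z = (z' - F (a i)) - (z - F (a i)) by abel, inner_sub_left,
        show (z' - F (a i)) - (z - F (a i)) = z' - z by abel, ← dist_eq_norm, dist_comm] at h5
      have h6 : Δ i = l i * (1 + σ) + l i := by simp only [hΔ]; ring
      dsimp only at h1 h2
      linarith
    intro i j j' hjj z hz z' hz'
    rcases lt_or_gt_of_ne hjj with h | h
    · exact key i j j' h z hz z' hz'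
    · rw [dist_comm]; exact key i j' j h z' hz' z hz
  -- cylinders at different levels
  have hdiff : ∀ p p' : J × Fin P, p.1 < p'.1 → ∀ z ∈ (A p).carrier, ∀ z' ∈ (A p').carrier,
      l p.1 * (1 + σ) ≤ dist z z' := by
    intro p p' hpp z hz z' hz'
    have hlt : ((p.1 : ℕ)) + 1 ≤ p'.1 := hpp
    have h1 := hnear p' z' hz'
    have h2 := hc.dist_le hlt (hJk p'.1).le
    have h3 : L p'.1 ≤ L (p.1 + 1) := scale_anti hr hq hlt
    -- Every cylinder of a deeper level lies within `2 L p'.1 + L (p.1 + 1) ≤ 3 L (p.1 + 1)` of `F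
    -- (a (p.1 + 1))`. This uses up at most `l` of the margin `Δ = l (1 + σ) + l`.
    have h4 : 3 * L (p.1 + 1) ≤ l p.1 := by
      simp only [hLdef, scale_succ, hl]
      have := scale_pos hr hq p.1
      rw [← mul_div_assoc, div_le_div_iff₀ (by positivity) (by positivity)]
      have h5 : (q : ℝ) * σ ≤ 2 * (q ^ 4 + q) := by
        have : (q : ℝ) * σ ≤ q * q := by gcongr
        have : (q : ℝ) ^ 2 ≤ q ^ 4 := pow_le_pow_right₀ (by linarith) (by norm_num)
        nlinarith
      nlinarith
    have h5 := hgap p.1 p.2 _ (hheight p z hz)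
    simp only [hH] at h5
    rw [← inner_sub_left, show (z - F (a p.1)) - (F (a (p.1 + 1)) - F (a p.1))
      = z - F (a (p.1 + 1)) by abel] at h5
    have h6 := h5.trans (abs_inner_le_of_norm_eq_one (he1 p.1))
    rw [← dist_eq_norm] at h6
    have h7 := dist_triangle z z' (F (a (p.1 + 1)))
    have h8 := dist_triangle z' (F (a p'.1)) (F (a (p.1 + 1)))
    rw [dist_comm (F (a p'.1))] at h8
    have h9 : Δ p.1 = l p.1 * (1 + σ) + l p.1 := by simp only [hΔ]; ring
    linarith
  refine ⟨A, ?_, fun p => ?_, fun p => axisCylinder_length, ?_⟩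
  · intro p p' hpp z hz z' hz'
    refine (hdiam p).trans ?_
    rw [edist_dist]
    refine ENNReal.ofReal_le_ofReal ?_
    obtain ⟨i, j⟩ := p
    obtain ⟨i', j'⟩ := p'
    rcases lt_trichotomy i i' with h | rfl | h
    · exact hdiff _ _ h z hz z' hz'
    · exact hsame i j j' (by rintro rfl; exact hpp rfl) z hz z' hz'
    · rw [dist_comm]
      refine le_trans ?_ (hdiff _ _ h z' hz' z hz)
      have h1 : L i ≤ L i' := scale_anti hr hq (Subtype.coe_le_coe.2 h.le)
      simp only [hl]
      gcongr
  · rw [show (A p).length = l p.1 from axisCylinder_length, mul_comm, ← hw]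
    rfl
  · intro Λ C f hf a' b' hc' hst hda hdb p
    have hp := hJk p.1
    have h0 := hc'.Icc_subset (Nat.zero_le p.1) hp.le
    exact traverses_axisCylinder hf (hL p.1) (hc'.zero_le.trans h0.1) (h0.2.trans hc'.le_one)
      (hc'.seg p.1 hp.le) (hst p.1 p.1.2) (hc.seg p.1 hp.le).dist_eq (hda p.1 p.1.2)
      (hdb p.1 p.1.2) (he1 p.1) (hl0 p.1) (hw0 p.1) (hlow p.1 p.2) (hhigh p.1 p.2)

end Family

/-! ### Discretization of chains -/

section Net

variable {d : ℕ}

theorem norm_le_of_forall_abs_le {u : E d} {ε : ℝ} (hε : 0 ≤ ε) (h : ∀ j, |u j| ≤ ε) :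
    ‖u‖ ≤ (d + 1) * ε := by
  refine abs_le_of_sq_le_sq' ?_ (by positivity) |>.2
  rw [EuclideanSpace.norm_sq_eq]
  calc ∑ j, ‖u j‖ ^ 2 ≤ ∑ _j : Fin d, ε ^ 2 := by
        refine Finset.sum_le_sum fun j _ => ?_
        exact pow_le_pow_left₀ (norm_nonneg _) (h j) 2
    _ = d * ε ^ 2 := by simp
    _ ≤ ((d + 1) * ε) ^ 2 := by
        have : (0 : ℝ) ≤ d := Nat.cast_nonneg d
        nlinarith [mul_nonneg (sq_nonneg ε) (by nlinarith : (0 : ℝ) ≤ (d : ℝ) ^ 2 + d + 1)]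

/-- A net of the unit ball at scale `1 / Z` with polynomially many points. -/
theorem exists_net (d : ℕ) {Z : ℕ} (hZ : 0 < Z) :
    ∃ T : (Fin d → Fin (2 * ((d + 1) * Z) + 1)) → E d, ∀ v : E d, ‖v‖ ≤ 1 →
      ∃ c, ‖v - T c‖ ≤ 1 / Z := by
  set M : ℕ := (d + 1) * Z with hM
  have hM0 : (0 : ℝ) < M := by rw [hM]; positivity
  refine ⟨fun c => WithLp.toLp 2 fun j => ((c j : ℕ) : ℝ) / M - 1, fun v hv => ?_⟩
  have hvj : ∀ j, |v j| ≤ 1 := fun j => (PiLp.norm_apply_le v j).trans hv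
  have hnn : ∀ j, 0 ≤ (v j + 1) * M := fun j =>
    mul_nonneg (by linarith [(abs_le.1 (hvj j)).1]) hM0.le
  have hlt : ∀ j, ⌊(v j + 1) * M⌋₊ < 2 * M + 1 := fun j => by
    refine Nat.lt_succ_of_le (Nat.floor_le_of_le ?_)
    push_cast
    exact mul_le_mul_of_nonneg_right (by linarith [(abs_le.1 (hvj j)).2]) hM0.le
  refine ⟨fun j => ⟨⌊(v j + 1) * M⌋₊, hlt j⟩, ?_⟩
  have e : (1 : ℝ) / Z = (d + 1) * (1 / M) := by
    have : (0 : ℝ) < Z := by exact_mod_cast hZ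
    rw [hM]; push_cast; field_simp
  rw [e]
  refine norm_le_of_forall_abs_le (by positivity) fun j => ?_
  have h1 := Nat.floor_le (hnn j)
  have h2 := (Nat.lt_floor_add_one ((v j + 1) * M)).le
  have h3 : (v - WithLp.toLp 2 fun j => ((⌊(v j + 1) * M⌋₊ : ℕ) : ℝ) / M - 1 : E d) j
      = ((v j + 1) * M - ⌊(v j + 1) * M⌋₊) / M := by
    simp only [PiLp.sub_apply]
    field_simp
    ring
  change |(v - WithLp.toLp 2 fun j => ((⌊(v j + 1) * M⌋₊ : ℕ) : ℝ) / M - 1 : E d) j| ≤ _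
  rw [h3, abs_div, abs_of_pos hM0, abs_of_nonneg (by linarith)]
  gcongr
  linarith

/-- The position encoded by the increments `2 L_j t_j`. -/
def codePos (L : ℕ → ℝ) (x₀ : E d) (t : ℕ → E d) (i : ℕ) : E d :=
  x₀ + ∑ j ∈ Finset.range i, (2 * L j) • t j

theorem codePos_congr {L : ℕ → ℝ} {x₀ : E d} {t t' : ℕ → E d} {i : ℕ} (h : ∀ j < i, t j = t' j) :
    codePos L x₀ t i = codePos L x₀ t' i := by
  unfold codePos
  congr 1
  exact Finset.sum_congr rfl fun j hj => by rw [h j (Finset.mem_range.1 hj)]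

theorem exists_net_step {ι : Type*} {T : ι → E d} {ζ : ℝ}
    (hT : ∀ v : E d, ‖v‖ ≤ 1 → ∃ c, ‖v - T c‖ ≤ ζ) {l : ℝ} (hl : 0 < l) {x y : E d}
    (h : ‖y - x‖ ≤ 2 * l) : ∃ c, ‖y - (x + (2 * l) • T c)‖ ≤ 2 * l * ζ := by
  have hl2 : 0 < 2 * l := by linarith
  obtain ⟨c, hc⟩ := hT ((2 * l)⁻¹ • (y - x)) (by
    rw [norm_smul, norm_inv, Real.norm_of_nonneg hl2.le, inv_mul_le_iff₀ hl2, mul_one]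
    exact h)
  refine ⟨c, ?_⟩
  have e : y - (x + (2 * l) • T c) = (2 * l) • ((2 * l)⁻¹ • (y - x) - T c) := by
    rw [smul_sub, smul_smul, mul_inv_cancel₀ hl2.ne', one_smul]; abel
  rw [e, norm_smul, Real.norm_of_nonneg hl2.le]
  exact mul_le_mul_of_nonneg_left hc hl2.le

/-- Errors do not accumulate: each increment is measured from the encoded position, not the true
one. The true step plus the current error is at most `2 L i`, and rounding it leaves an error `2 L i
ζ ≤ τ L (i + 1)`, adapted to the next scale. -/
theorem exists_code {ι : Type*} [Nonempty ι] {T : ι → E d} {ζ τ : ℝ}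
    (hT : ∀ v : E d, ‖v‖ ≤ 1 → ∃ c, ‖v - T c‖ ≤ ζ) {L : ℕ → ℝ} (hL : ∀ i, 0 < L i) (hτ : τ ≤ 1)
    (hζ : ∀ i, 2 * L i * ζ ≤ τ * L (i + 1)) {x : ℕ → E d} {x₀ : E d}
    (h0 : ‖x 0 - x₀‖ ≤ τ * L 0) {k : ℕ} (hx : ∀ i < k, ‖x (i + 1) - x i‖ ≤ L i) :
    ∃ c : ℕ → ι, ∀ i ≤ k, ‖x i - codePos L x₀ (T ∘ c) i‖ ≤ τ * L i := by
  induction k with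
  | zero =>
    refine ⟨fun _ => Classical.arbitrary ι, fun i hi => ?_⟩
    obtain rfl : i = 0 := by omega
    simpa [codePos] using h0
  | succ k ih =>
    obtain ⟨c, hc⟩ := ih fun i hi => hx i (by omega)
    obtain ⟨c', hc'⟩ := exists_net_step hT (hL k) (x := codePos L x₀ (T ∘ c) k) (y := x (k + 1)) (by
      have h1 := hc k le_rfl
      have h2 := hx k (by omega)
      have h3 := norm_add_le (x (k + 1) - x k) (x k - codePos L x₀ (T ∘ c) k)
      rw [sub_add_sub_cancel] at h3
      have h4 := mul_le_mul_of_nonneg_right hτ (hL k).le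
      linarith)
    have e : ∀ i ≤ k, codePos L x₀ (T ∘ Function.update c k c') i = codePos L x₀ (T ∘ c) i :=
      fun i hi => codePos_congr fun j hj => by
        simp only [Function.comp, Function.update_of_ne (show j ≠ k by omega)]
    refine ⟨Function.update c k c', fun i hi => ?_⟩
    rcases Nat.lt_or_ge i (k + 1) with h | h
    · rw [e i (by omega)]; exact hc i (by omega)
    · obtain rfl : i = k + 1 := by omega
      rw [codePos, Finset.sum_range_succ, ← add_assoc, ← codePos, e k le_rfl]
      simpa using hc'.trans (hζ k)

end Net

/-! ### The probability that straight segments are not sparse -/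

section Probability

variable {d : ℕ} {Λ : Set (E d)}

/-- Some curve of the configuration has a chain of depth `k` more than half of whose levels are
straight. -/
def straightEvent (Λ : Set (E d)) (q : ℕ) (r : ℝ) (k : ℕ) : Set (Config Λ) :=
  {F | ∃ C ∈ F, ∃ f : ParamCurve Λ, C.IsParam f ∧ ∃ a b : ℕ → ℝ,
    IsChain f.path (scale r q) k a b ∧
      k < 2 * (straightLevels f.path q (scale r q) k a b).card}

theorem WellSeparated.comp {ι ι' : Type*} {A : ι → Set (E d)} (h : WellSeparated A) {e : ι' → ι}
    (he : Function.Injective e) : WellSeparated (fun i => A (e i)) :=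
  fun i j hij => h (e i) (e j) (he.ne hij)

/-- The points of a chain are within `L i / (6 q)` of prescribed positions and its straight levels
are prescribed. -/
def HasCode (f : ParamCurve Λ) (q : ℕ) (L : ℕ → ℝ) (k : ℕ) (a b : ℕ → ℝ) (X Y : ℕ → E d)
    (J : Finset ℕ) : Prop :=
  straightLevels f.path q L k a b = J ∧ ∀ i < k,
    ‖f.path (a i) - X i‖ ≤ 1 / (6 * q) * L i ∧ ‖f.path (b i) - Y i‖ ≤ 1 / (6 * q) * L i

open Classical in
theorem straightLevels_subset {F : ℝ → E d} {q : ℕ} {L : ℕ → ℝ} {k : ℕ} {a b : ℕ → ℝ} :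
    straightLevels F q L k a b ⊆ Finset.range k :=
  Finset.filter_subset _ _

open Classical in
theorem isStraight_of_mem_straightLevels {F : ℝ → E d} {q : ℕ} {L : ℕ → ℝ} {k : ℕ} {a b : ℕ → ℝ}
    {i : ℕ} (h : i ∈ straightLevels F q L k a b) : IsStraight F (2 * L i / q) (a i) (b i) :=
  (Finset.mem_filter.1 h).2

/-- If some chain has the given code, take it as reference. Any other chain with that code is within
`2 L i / (6 q) = L i / (3 q)` of it, so its curve crosses the same cylinders, and there are `2 p`
for each of more than `k / 2` levels. -/
theorem measure_hasCode_le {σ ρ K : ℝ} (hσ : 0 < σ) (hρ0 : 0 ≤ ρ) (hρ1 : ρ < 1)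
    {m : Measure (Config Λ)} [IsProbabilityMeasure m] {δ : ℝ}
    (H : ∀ (k : ℕ) (A : Fin k → Cylinder d), WellSeparated (fun j => (A j).carrier) →
      (∀ j, (A j).width = σ * (A j).length) → (∀ j, δ ≤ (A j).length) →
      m.real {F | ∀ j, ∃ C ∈ F, C.Traverses (A j)} ≤ K * ρ ^ k)
    {r : ℝ} {q p k : ℕ} (hr : 0 < r) (hq : 3 ≤ q) (hσq : σ ≤ q)
    (hP : (((2 * p : ℕ) : ℝ) + 1) * (6 * (2 + σ) / (q * σ)) + 1 / (3 * q) ≤ 1 / 2)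
    (hδ : ∀ i < k, δ ≤ 6 * scale r q i / (q * σ)) (X Y : ℕ → E d) (J : Finset ℕ) :
    m.real {F : Config Λ | ∃ C ∈ F, ∃ f : ParamCurve Λ, C.IsParam f ∧ ∃ a b : ℕ → ℝ,
      IsChain f.path (scale r q) k a b ∧ k < 2 * J.card ∧
        HasCode f q (scale r q) k a b X Y J} ≤ K * (ρ ^ p) ^ k := by
  -- The case of the empty family, `k = 0`.
  have hK : 0 ≤ K := by
    have := measureReal_nonneg.trans
      (H 0 (fun j => j.elim0) (fun j => j.elim0) (fun j => j.elim0) (fun j => j.elim0))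
    simpa using this
  rcases Set.eq_empty_or_nonempty {F : Config Λ | ∃ C ∈ F, ∃ f : ParamCurve Λ, C.IsParam f ∧
      ∃ a b : ℕ → ℝ, IsChain f.path (scale r q) k a b ∧ k < 2 * J.card ∧
        HasCode f q (scale r q) k a b X Y J} with hemp | ⟨F₀, C₀, -, f₀, -, a, b, hc, hJk, hJ, hXY⟩
  · rw [hemp, measureReal_empty]; positivity
  have hJsub : J ⊆ Finset.range k := hJ ▸ straightLevels_subset
  obtain ⟨A, hA1, hA2, hA3, hA4⟩ := exists_cylinder_family hr hq hσ hσq hP hc hJsub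
  let e := (Fintype.equivFin (J × Fin (2 * p))).symm
  have hbound := H _ (fun j => A (e j)) (hA1.comp e.injective) (fun j => hA2 _) (fun j => by
    rw [hA3]
    exact hδ _ (Finset.mem_range.1 (hJsub (e j).1.2)))
  have hcard : Fintype.card (J × Fin (2 * p)) = J.card * (2 * p) := by simp
  refine le_trans (measureReal_mono ?_) (hbound.trans ?_)
  · rintro F ⟨C, hCF, f, hf, a', b', hc', -, hJ', hXY'⟩ j
    have hclose : ∀ i (u v w : E d), ‖u - w‖ ≤ 1 / (6 * q) * scale r q i →
        ‖v - w‖ ≤ 1 / (6 * q) * scale r q i → dist u v ≤ scale r q i / (3 * q) := by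
      intro i u v w h1 h2
      rw [← dist_eq_norm] at h1 h2
      have h3 := dist_triangle_right u v w
      have h4 : scale r q i / (3 * q) = 1 / (6 * q) * scale r q i + 1 / (6 * q) * scale r q i := by
        have : (0 : ℝ) < q := by exact_mod_cast (by omega : 0 < q)
        field_simp; ring
      linarith
    refine ⟨C, hCF, hA4 Λ C f hf a' b' hc' (fun i hi => ?_) (fun i hi => ?_) (fun i hi => ?_) _⟩
    · exact isStraight_of_mem_straightLevels (hJ' ▸ hi)
    · have := Finset.mem_range.1 (hJsub hi)
      exact hclose i _ _ _ (hXY' i this).1 (hXY i this).1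
    · have := Finset.mem_range.1 (hJsub hi)
      exact hclose i _ _ _ (hXY' i this).2 (hXY i this).2
  · rw [hcard, ← pow_mul]
    refine mul_le_mul_of_nonneg_left (pow_le_pow_of_le_one hρ0 hρ1.le ?_) hK
    calc p * k ≤ p * (2 * J.card) := Nat.mul_le_mul_left _ hJk.le
      _ = J.card * (2 * p) := by ring

/-- The number of points of the net that is used to encode one step of a chain. -/
def netCard (d q : ℕ) : ℕ := (2 * ((d + 1) * (12 * q * (q ^ 4 + q))) + 1) ^ d

/-- Union bound over codes: `C₀` starting balls covering `Λ`, one net point per level for each of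
the two end points, and `2 ^ k` sets of straight levels. -/
theorem exists_measure_straightEvent_le (hΛ : IsCompact Λ) {σ ρ K : ℝ} (hσ : 0 < σ)
    (hρ0 : 0 ≤ ρ) (hρ1 : ρ < 1) {r : ℝ} {q p : ℕ} (hr : 0 < r) (hq : 3 ≤ q) (hσq : σ ≤ q)
    (hP : (((2 * p : ℕ) : ℝ) + 1) * (6 * (2 + σ) / (q * σ)) + 1 / (3 * q) ≤ 1 / 2) :
    ∃ C₀ : ℕ, ∀ (m : Measure (Config Λ)) [IsProbabilityMeasure m] (δ : ℝ),
      (∀ (k : ℕ) (A : Fin k → Cylinder d), WellSeparated (fun j => (A j).carrier) →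
        (∀ j, (A j).width = σ * (A j).length) → (∀ j, δ ≤ (A j).length) →
        m.real {F | ∀ j, ∃ C ∈ F, C.Traverses (A j)} ≤ K * ρ ^ k) →
      ∀ k, (∀ i < k, δ ≤ 6 * scale r q i / (q * σ)) →
        m.real (straightEvent Λ q r k) ≤ C₀ * K * (2 * (netCard d q) ^ 2 * ρ ^ p) ^ k := by
  have hq0 : (3 : ℝ) ≤ q := by exact_mod_cast hq
  have hqp : (0 : ℝ) < q := by linarith
  set τ : ℝ := 1 / (6 * q) with hτ
  have hτ0 : 0 < τ := by positivity
  have hτ1 : τ ≤ 1 := by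
    rw [hτ, div_le_one (by positivity)]; linarith
  obtain ⟨t₀, -, ht₀, hcover⟩ := hΛ.finite_cover_balls (e := τ * r) (by positivity)
  have : Finite t₀ := ht₀
  have := Fintype.ofFinite t₀
  -- Chosen so that `2 L i / Z` equals `τ L (i + 1)`.
  set Z : ℕ := 12 * q * (q ^ 4 + q) with hZ
  obtain ⟨T, hT⟩ := exists_net d (Z := Z) (by positivity)
  have hL : ∀ i, 0 < scale r q i := scale_pos hr hq
  have hζ : ∀ i, 2 * scale r q i * (1 / Z) ≤ τ * scale r q (i + 1) := fun i => by
    have := hL i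
    rw [scale_succ, hτ, hZ]
    push_cast
    apply le_of_eq
    field_simp
    norm_num
  refine ⟨Fintype.card t₀, fun m _ δ H k hδ => ?_⟩
  let ι := Fin d → Fin (2 * ((d + 1) * Z) + 1)
  let Code := t₀ × (Fin k → ι) × (Fin k → ι) × {J // J ∈ (Finset.range k).powerset}
  have : Nonempty ι := ⟨fun _ => 0⟩
  let ext : (Fin k → ι) → ℕ → ι := fun c i => if h : i < k then c ⟨i, h⟩ else Classical.arbitrary ι
  let X : Code → ℕ → E d := fun c => codePos (scale r q) c.1 (T ∘ ext c.2.1)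
  let Y : Code → ℕ → E d := fun c i => X c i + (2 * scale r q i) • T (ext c.2.2.1 i)
  have hsub : straightEvent Λ q r k ⊆ ⋃ c : Code, {F : Config Λ | ∃ C ∈ F, ∃ f : ParamCurve Λ,
      C.IsParam f ∧ ∃ a b : ℕ → ℝ, IsChain f.path (scale r q) k a b ∧ k < 2 * c.2.2.2.1.card ∧
        HasCode f q (scale r q) k a b (X c) (Y c) c.2.2.2.1} := by
    rintro F ⟨C, hCF, f, hf, a, b, hc, hk⟩
    have hmem : f.path (a 0) ∈ Λ := Subtype.coe_prop _
    obtain ⟨x₀, hx₀, hx₀'⟩ := Set.mem_iUnion₂.1 (hcover hmem)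
    rw [Metric.mem_ball, dist_eq_norm] at hx₀'
    obtain ⟨c, hcX⟩ := exists_code hT hL hτ1 hζ (x := fun i => f.path (a i)) (x₀ := x₀)
      (by simpa [scale] using hx₀'.le) (k := k) (fun i hi => by
        rw [← dist_eq_norm, dist_comm]
        exact hc.dist_le (Nat.le_succ i) hi)
    have hY : ∀ i : ℕ, ∃ c' : ι, i < k → ‖f.path (b i) - (codePos (scale r q) x₀ (T ∘ c) i
        + (2 * scale r q i) • T c')‖ ≤ τ * scale r q i := by
      intro i
      by_cases hi : i < k
      · obtain ⟨c', hc'⟩ := exists_net_step hT (hL i) (x := codePos (scale r q) x₀ (T ∘ c) i)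
          (y := f.path (b i)) (by
            have h1 := hcX i hi.le
            have h2 := (hc.seg i hi.le).dist_eq
            rw [dist_comm, dist_eq_norm] at h2
            have h3 := norm_add_le (f.path (b i) - f.path (a i))
              (f.path (a i) - codePos (scale r q) x₀ (T ∘ c) i)
            rw [sub_add_sub_cancel] at h3
            have h4 := mul_le_mul_of_nonneg_right hτ1 (hL i).le
            linarith)
        refine ⟨c', fun _ => hc'.trans ((hζ i).trans ?_)⟩
        exact mul_le_mul_of_nonneg_left (scale_anti hr hq (Nat.le_succ i)) hτ0.le
      · exact ⟨Classical.arbitrary ι, fun h => absurd h hi⟩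
    choose c' hc' using hY
    have hext : ∀ (g : ℕ → ι) i, i < k → ext (fun j => g j) i = g i := fun g i hi => by
      simp only [ext, hi, dif_pos]
    refine Set.mem_iUnion.2 ⟨(⟨x₀, hx₀⟩, fun j => c j, fun j => c' j,
      ⟨straightLevels f.path q (scale r q) k a b,
        Finset.mem_powerset.2 straightLevels_subset⟩), C, hCF, f, hf, a, b, hc, hk, rfl, ?_⟩
    intro i hi
    have e : codePos (scale r q) x₀ (T ∘ ext (fun j => c j)) i
        = codePos (scale r q) x₀ (T ∘ c) i := codePos_congr fun j hj => by
      simp only [Function.comp, hext c j (by omega)]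
    refine ⟨?_, ?_⟩
    · change ‖f.path (a i) - codePos (scale r q) x₀ (T ∘ ext (fun j => c j)) i‖ ≤ _
      rw [e]; exact hcX i hi.le
    · change ‖f.path (b i) - (codePos (scale r q) x₀ (T ∘ ext (fun j => c j)) i
        + (2 * scale r q i) • T (ext (fun j => c' j) i))‖ ≤ _
      rw [e, hext c' i hi]; exact hc' i hi
  refine (measureReal_mono hsub).trans ((measureReal_iUnion_fintype_le _).trans ?_)
  refine (Finset.sum_le_card_nsmul _ _ (K * (ρ ^ p) ^ k) fun c _ =>
    measure_hasCode_le hσ hρ0 hρ1 H hr hq hσq hP hδ _ _ _).trans_eq ?_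
  have hcard : Fintype.card Code = Fintype.card t₀ * ((netCard d q) ^ k * ((netCard d q) ^ k
      * 2 ^ k)) := by
    simp only [Code, ι, Fintype.card_prod, Fintype.card_fun, Fintype.card_fin, Fintype.card_coe,
      Finset.card_powerset, Finset.card_range, netCard, hZ]
  rw [Finset.card_univ, hcard, nsmul_eq_mul]
  push_cast
  rw [mul_pow, mul_pow]
  ring

end Probability

/-! ### Capacities are stochastically bounded away from zero -/

theorem netCard_le (d : ℕ) {q : ℕ} (hq : 1 ≤ q) : netCard d q ≤ (49 * (d + 1) * q ^ 5) ^ d := by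
  refine Nat.pow_le_pow_left ?_ d
  have h1 : q ≤ q ^ 4 := Nat.le_self_pow (by norm_num) q
  have h2 : 1 ≤ q ^ 5 := Nat.one_le_pow _ _ hq
  calc 2 * ((d + 1) * (12 * q * (q ^ 4 + q))) + 1
      ≤ 2 * ((d + 1) * (12 * q * (q ^ 4 + q ^ 4))) + (d + 1) * q ^ 5 := by
        gcongr
        nlinarith
    _ = 49 * (d + 1) * q ^ 5 := by ring

/-- Fitting `2 p` cylinders on an axis requires `q` proportional to `p`, whence `q = Q p`. The
entropy `netCard ^ 2` is then bounded by a constant times `p ^ (10 d)`, which the exponential `ρ ^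
p` beats. -/
theorem exists_parameters (d : ℕ) {σ ρ : ℝ} (hσ : 0 < σ) (hρ0 : 0 ≤ ρ) (hρ1 : ρ < 1) :
    ∃ q p : ℕ, 3 ≤ q ∧ σ ≤ q ∧
      (((2 * p : ℕ) : ℝ) + 1) * (6 * (2 + σ) / (q * σ)) + 1 / (3 * q) ≤ 1 / 2 ∧
      2 * (netCard d q : ℝ) ^ 2 * ρ ^ p ≤ 1 / 2 := by
  obtain ⟨Q, hQ⟩ := exists_nat_ge (40 + 80 / σ + σ)
  have h80 : 0 < 80 / σ := by positivity
  have hQ40 : (40 : ℝ) ≤ Q := by linarith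
  set c : ℝ := 2 * ((49 * (d + 1) * Q ^ 5) ^ d) ^ 2 with hc
  have hlim : Tendsto (fun p : ℕ => c * ((p : ℝ) ^ (10 * d) * ρ ^ p)) atTop (𝓝 0) := by
    simpa using (tendsto_pow_const_mul_const_pow_of_abs_lt_one (10 * d)
      (by rwa [abs_of_nonneg hρ0])).const_mul c
  obtain ⟨p, hp, hp1⟩ := ((hlim.eventually_lt_const (by norm_num : (0 : ℝ) < 1 / 2)).and
    (eventually_ge_atTop 1)).exists
  have hp1' : (1 : ℝ) ≤ p := by exact_mod_cast hp1
  have hQn : 40 ≤ Q := by exact_mod_cast hQ40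
  have hq : Q ≤ Q * p := Nat.le_mul_of_pos_right _ hp1
  have hqR : (Q : ℝ) ≤ Q * p := by exact_mod_cast hq
  refine ⟨Q * p, p, by omega, ?_, ?_, ?_⟩
  · push_cast; linarith
  · push_cast
    have hQσ : 40 * (2 + σ) ≤ Q * σ := by
      have := mul_le_mul_of_nonneg_right hQ hσ.le
      have e : (40 + 80 / σ + σ) * σ = 40 * σ + 80 + σ * σ := by field_simp
      nlinarith
    have h1 : (2 * (p : ℝ) + 1) * (6 * (2 + σ) / (Q * p * σ)) ≤ 9 / 20 := by
      have hQp : (0 : ℝ) < Q * p * σ := by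
        have : (0 : ℝ) < Q := by linarith
        positivity
      rw [← mul_div_assoc, div_le_div_iff₀ hQp (by norm_num)]
      have h2 : (2 * (p : ℝ) + 1) * (6 * (2 + σ)) ≤ (3 * p) * (6 * (2 + σ)) := by
        gcongr; linarith
      nlinarith [mul_le_mul_of_nonneg_left hQσ (by linarith : (0 : ℝ) ≤ p)]
    have h3 : 1 / (3 * ((Q : ℝ) * p)) ≤ 1 / 120 :=
      one_div_le_one_div_of_le (by norm_num) (by linarith)
    linarith
  · refine le_trans ?_ hp.le
    have h1 := netCard_le d (q := Q * p) (by omega)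
    have h2 : (netCard d (Q * p) : ℝ) ≤ (49 * (d + 1) * (Q * p) ^ 5) ^ d := by exact_mod_cast h1
    calc 2 * (netCard d (Q * p) : ℝ) ^ 2 * ρ ^ p
        ≤ 2 * ((49 * (d + 1) * ((Q : ℝ) * p) ^ 5) ^ d) ^ 2 * ρ ^ p := by gcongr
      _ = c * ((p : ℝ) ^ (10 * d) * ρ ^ p) := by
        have e : (49 * (d + 1) * ((Q : ℝ) * p) ^ 5) ^ d
            = (49 * (d + 1) * (Q : ℝ) ^ 5) ^ d * ((p : ℝ) ^ 5) ^ d := by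
          rw [← mul_pow]; ring
        rw [hc, e, show 10 * d = 5 * d * 2 by ring, pow_mul (p : ℝ) (5 * d), pow_mul (p : ℝ) 5]
        ring

section Capacity

variable {d : ℕ} {Λ : Set (E d)}

theorem Curve.exists_isParam (C : Curve Λ) : ∃ f : ParamCurve Λ, C.IsParam f :=
  SeparationQuotient.surjective_mk C

theorem Curve.trace_eq_of_isParam {C : Curve Λ} {f : ParamCurve Λ} (hf : C.IsParam f) :
    C.trace = Set.range f.eval := by
  rw [← hf]; exact trace_mk f

theorem ParamCurve.image_path (f : ParamCurve Λ) : f.path '' Set.Icc 0 1 = Set.range f.eval := by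
  ext x
  constructor
  · rintro ⟨t, -, rfl⟩
    exact ⟨_, rfl⟩
  · rintro ⟨t, rfl⟩
    exact ⟨t, t.2, f.path_coe t⟩

theorem Curve.isCompact_trace (C : Curve Λ) : IsCompact C.trace := by
  obtain ⟨f, hf⟩ := C.exists_isParam
  rw [trace_eq_of_isParam hf]
  exact isCompact_range f.continuous_eval

theorem Curve.exists_le_dist_path {C : Curve Λ} {f : ParamCurve Λ} (hf : C.IsParam f) {r : ℝ}
    (h : r ≤ C.diam) : ∃ a b : ℝ, 0 ≤ a ∧ a ≤ b ∧ b ≤ 1 ∧ r ≤ dist (f.path a) (f.path b) := by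
  have hcont : Continuous fun p : I × I => dist (f.eval p.1) (f.eval p.2) :=
    (f.continuous_eval.comp continuous_fst).dist (f.continuous_eval.comp continuous_snd)
  obtain ⟨⟨s, t⟩, hmax⟩ : ∃ p : I × I, ∀ p' : I × I,
      dist (f.eval p'.1) (f.eval p'.2) ≤ dist (f.eval p.1) (f.eval p.2) := by
    obtain ⟨p, -, hp⟩ := isCompact_univ.exists_isMaxOn Set.univ_nonempty hcont.continuousOn
    exact ⟨p, fun p' => hp (Set.mem_univ p')⟩
  have hd : r ≤ dist (f.path s) (f.path t) := by
    rw [f.path_coe, f.path_coe]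
    refine h.trans ?_
    rw [Curve.diam, trace_eq_of_isParam hf]
    refine Metric.diam_le_of_forall_dist_le dist_nonneg ?_
    rintro _ ⟨s', rfl⟩ _ ⟨t', rfl⟩
    exact hmax (s', t')
  rcases le_total s t with hst | hst
  · exact ⟨s, t, s.2.1, hst, t.2.2, hd⟩
  · exact ⟨t, s, t.2.1, hst, s.2.2, by rwa [dist_comm]⟩

theorem inv_minCapacity_le {s r δ : ℝ} {F : Config Λ} {u : ℝ≥0∞}
    (h : ∀ C ∈ F, r ≤ C.diam → ∃ ν : ProbabilityMeasure (E d),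
      (ν : Measure (E d)) C.traceᶜ = 0 ∧ energy s δ ν ≤ u) : (minCapacity s r δ F)⁻¹ ≤ u := by
  rw [ENNReal.inv_le_iff_inv_le, minCapacity]
  refine le_iInf fun C => le_iInf fun hC => le_iInf fun hr => ENNReal.inv_le_inv.2 ?_
  obtain ⟨ν, hν, hE⟩ := h C hC hr
  exact (iInf₂_le ν hν).trans hE

theorem stochasticallyBoundedAwayFromZero_minCapacity (hΛ : IsCompact Λ) {δmax : ℝ}
    {μ : Set.Ioc 0 δmax → ProbabilityMeasure (Config Λ)} {σ ρ K : ℝ} (hσ : 0 < σ) (hρ0 : 0 ≤ ρ)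
    (hρ1 : ρ < 1)
    (H : ∀ (δ : Set.Ioc 0 δmax) (k : ℕ) (A : Fin k → Cylinder d),
      WellSeparated (fun j => (A j).carrier) → (∀ j, (A j).width = σ * (A j).length) →
      (∀ j, (δ : ℝ) ≤ (A j).length) →
      (μ δ : Measure (Config Λ)).real {F | ∀ j, ∃ C ∈ F, C.Traverses (A j)} ≤ K * ρ ^ k)
    {q p : ℕ} (hq : 3 ≤ q) (hσq : σ ≤ q)
    (hP : (((2 * p : ℕ) : ℝ) + 1) * (6 * (2 + σ) / (q * σ)) + 1 / (3 * q) ≤ 1 / 2)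
    (hpow : 2 * (netCard d q : ℝ) ^ 2 * ρ ^ p ≤ 1 / 2) {r s : ℝ} (hr : 0 < r) (hs : 0 < s)
    (hsd : s < roughDim q) :
    StochasticallyBoundedAwayFromZero μ (fun δ F => minCapacity s r (δ : ℝ) F) := by
  intro ε hε
  have hqp : (0 : ℝ) < q := by exact_mod_cast (by omega : 0 < q)
  obtain ⟨C₀, hC₀⟩ := exists_measure_straightEvent_le (Λ := Λ) (K := K) hΛ hσ hρ0 hρ1 hr hq hσq hP
  have hA : 0 < q * σ / 6 := by positivity
  have hlim : Tendsto (fun k : ℕ => C₀ * |K| * 2 * (1 / 2 : ℝ) ^ k) atTop (𝓝 0) := by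
    simpa using (tendsto_pow_atTop_nhds_zero_of_lt_one (by norm_num : (0 : ℝ) ≤ 1 / 2)
      (by norm_num)).const_mul (C₀ * |K| * 2)
  obtain ⟨k₀, hk₀⟩ := (hlim.eventually_lt_const hε).exists
  obtain ⟨u, hu⟩ := exists_energy_le (d := d) hq hs hsd hr hA k₀
  -- The threshold event is a weak inequality, so it must lie strictly above the bound `u`.
  refine ⟨u + 1, fun δ => ?_⟩
  have hδ0 : (0 : ℝ) < δ := δ.2.1
  have hex : ∃ n, scale r q n < q * σ / 6 * δ := by
    have hγ := one_lt_base hq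
    have h0 : Tendsto (fun n : ℕ => r * ((1 : ℝ) / (q ^ 4 + q)) ^ n) atTop (𝓝 0) := by
      have := (tendsto_pow_atTop_nhds_zero_of_lt_one (r := (1 : ℝ) / (q ^ 4 + q))
        (by positivity) (by rw [div_lt_one (by linarith)]; exact hγ)).const_mul r
      rwa [mul_zero] at this
    obtain ⟨n, hn⟩ := (h0.eventually_lt_const (by positivity : 0 < q * σ / 6 * (δ : ℝ))).exists
    refine ⟨n, ?_⟩
    rwa [one_div, inv_pow, ← div_eq_mul_inv] at hn
  classical
  -- The first scale whose cylinders are shorter than `δ`. Above it **H2** applies at every level;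
  -- at depth `n` the cutoff bounds the energy.
  let n := Nat.find hex
  have hn1 : scale r q n < q * σ / 6 * δ := Nat.find_spec hex
  have hn2 : ∀ i < n, (δ : ℝ) ≤ 6 * scale r q i / (q * σ) := fun i hi => by
    have := not_lt.1 (Nat.find_min hex hi)
    rw [le_div_iff₀ (by positivity)]
    linarith
  have hsub : {F : Config Λ | ((u + 1 : ℝ≥0) : ℝ≥0∞) ≤ (minCapacity s r (δ : ℝ) F)⁻¹} ⊆
      ⋃ k ∈ Finset.Ico k₀ (n + 1), straightEvent Λ q r k := by
    intro F hF
    by_contra hnot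
    simp only [Set.mem_iUnion, exists_prop, not_exists, not_and, Finset.mem_Ico] at hnot
    have hle : (minCapacity s r (δ : ℝ) F)⁻¹ ≤ u := by
      refine inv_minCapacity_le fun C hC hCr => ?_
      obtain ⟨f, hf⟩ := C.exists_isParam
      obtain ⟨a, b, ha, hab, hb, hd⟩ := Curve.exists_le_dist_path hf hCr
      obtain ⟨ν, hν, hE⟩ := hu f.path f.continuous_path δ hδ0 n hn1 (fun k hk hkn a b hc => by
        by_contra hlt
        exact hnot k ⟨hk, by omega⟩ ⟨C, hC, f, hf, a, b, hc, by omega⟩) a b ha hab hb hd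
      rw [f.image_path, ← Curve.trace_eq_of_isParam hf] at hν
      exact ⟨ν, hν, hE⟩
    have h1 : ((u + 1 : ℝ≥0) : ℝ≥0∞) ≤ u := le_trans hF hle
    have h2 : u + 1 ≤ u := by exact_mod_cast h1
    exact absurd h2 (not_le.2 (lt_add_one u))
  have hterm : ∀ k ∈ Finset.Ico k₀ (n + 1),
      (μ δ : Measure (Config Λ)).real (straightEvent Λ q r k) ≤ C₀ * |K| * (1 / 2 : ℝ) ^ k := by
    intro k hk
    refine (hC₀ (μ δ : Measure (Config Λ)) δ (H δ) k
      fun i hi => hn2 i (by have := (Finset.mem_Ico.1 hk).2; omega)).trans ?_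
    gcongr
    exact le_abs_self K
  calc (μ δ : Measure (Config Λ)).real _
      ≤ (μ δ : Measure (Config Λ)).real (⋃ k ∈ Finset.Ico k₀ (n + 1), straightEvent Λ q r k) :=
        measureReal_mono hsub (measure_ne_top _ _)
    _ ≤ ∑ k ∈ Finset.Ico k₀ (n + 1), (μ δ : Measure (Config Λ)).real (straightEvent Λ q r k) :=
        measureReal_biUnion_finset_le _ _
    _ ≤ ∑ k ∈ Finset.Ico k₀ (n + 1), C₀ * |K| * (1 / 2 : ℝ) ^ k := Finset.sum_le_sum hterm
    _ ≤ C₀ * |K| * 2 * (1 / 2 : ℝ) ^ k₀ := by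
        rw [← Finset.mul_sum, mul_assoc _ (2 : ℝ)]
        refine mul_le_mul_of_nonneg_left ?_ (by positivity)
        rcases le_total k₀ (n + 1) with h | h
        · rw [geom_sum_Ico (by norm_num) h]
          have : (0 : ℝ) ≤ (1 / 2) ^ (n + 1) := by positivity
          rw [div_le_iff_of_neg (by norm_num)]
          linarith
        · rw [Finset.Ico_eq_empty_of_le h, Finset.sum_empty]; positivity
    _ ≤ ε := hk₀.le

end Capacity

/-! ### Semicontinuity of the minimal energy -/

section MinEnergy

variable {d : ℕ} {Λ : Set (E d)}

/-- The infimum of the energies of the probability measures supported on `A`, i.e. the inverse of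
the capacity. -/
def minEnergy (s ℓ : ℝ) (A : Set (E d)) : ℝ≥0∞ :=
  ⨅ (ν : ProbabilityMeasure (E d)) (_ : (ν : Measure (E d)) Aᶜ = 0), energy s ℓ ν

theorem inv_capacity (s ℓ : ℝ) (A : Set (E d)) : (capacity s ℓ A)⁻¹ = minEnergy s ℓ A :=
  inv_inv _

theorem minEnergy_anti {s : ℝ} (hs : 0 ≤ s) {ℓ ℓ' : ℝ} (h : ℓ ≤ ℓ') (A : Set (E d)) :
    minEnergy s ℓ' A ≤ minEnergy s ℓ A := by
  refine iInf₂_mono fun ν _ => lintegral_mono fun x => lintegral_mono fun y => ?_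
  exact rpow_neg_le_rpow_neg hs (max_le_max le_rfl (ENNReal.ofReal_le_ofReal h))

/-- A measurable map that moves the points close to `K` to points of `K` at distance less
than `ε`. -/
theorem exists_measurable_projection {K : Set (E d)} (hK : K.Nonempty) (ε : ℝ) :
    ∃ π : E d → E d, Measurable π ∧ (∀ x, π x ∈ K) ∧
      ∀ x, (∃ y ∈ K, dist x y < ε) → dist x (π x) < ε := by
  classical
  have : Nonempty K := hK.to_subtype
  let e : ℕ → E d := fun n => (denseSeq K n : K)
  -- The second alternative only makes `p x` satisfiable for points far from `K`, which are then
  -- sent to `e 0`.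
  let p : E d → ℕ → Prop := fun x n => dist x (e n) < ε ∨ ∀ m, ε ≤ dist x (e m)
  have hp : ∀ x, ∃ n, p x n := fun x => by
    by_cases h : ∃ n, dist x (e n) < ε
    · exact h.imp fun n hn => Or.inl hn
    · push Not at h
      exact ⟨0, Or.inr h⟩
  have hm : ∀ n, MeasurableSet {x | p x n} := fun n => by
    have h1 : MeasurableSet {x : E d | dist x (e n) < ε} :=
      (isOpen_lt (by fun_prop) continuous_const).measurableSet
    have h2 : MeasurableSet {x : E d | ∀ m, ε ≤ dist x (e m)} := by
      have : {x : E d | ∀ m, ε ≤ dist x (e m)} = ⋂ m, {x | ε ≤ dist x (e m)} := by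
        ext x; simp
      rw [this]
      exact MeasurableSet.iInter fun m =>
        (isClosed_le continuous_const (by fun_prop)).measurableSet
    exact h1.union h2
  refine ⟨fun x => e (Nat.find (hp x)), (measurable_from_nat (f := e)).comp (measurable_find hp hm),
    fun x => (denseSeq K _ : K).2, ?_⟩
  rintro x ⟨y, hy, hxy⟩
  rcases Nat.find_spec (hp x) with h | h
  · exact h
  · exfalso
    obtain ⟨n, hn⟩ := (denseRange_denseSeq K).exists_dist_lt ⟨y, hy⟩
      (show 0 < ε - dist x y by linarith)
    have h1 := h n
    have h2 := dist_triangle x y (e n)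
    have h3 : dist y (e n) < ε - dist x y := hn
    linarith

/-- Push a measure on `K'` forward to `K` by a map that moves points by less than `ε`. Distances
drop by at most `2 ε`, so the truncated distance `max (dist x y) ℓ` shrinks at most by the factor `1
- 2 ε / ℓ`. The positive cutoff is essential. -/
theorem minEnergy_le_of_close {s ℓ ε : ℝ} (hs : 0 ≤ s) (hℓ : 0 < ℓ) (hε : 0 ≤ ε) (hεℓ : 2 * ε < ℓ)
    {K K' : Set (E d)} (hKm : MeasurableSet K) (hK : K.Nonempty) (h : ∀ x ∈ K', ∃ y ∈ K, dist x y < ε) :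
    minEnergy s ℓ K ≤ ENNReal.ofReal (1 - 2 * ε / ℓ) ^ (-s) * minEnergy s ℓ K' := by
  set c : ℝ := 1 - 2 * ε / ℓ with hc
  have hc0 : 0 < c := by rw [hc, sub_pos, div_lt_one hℓ]; exact hεℓ
  obtain ⟨π, hπm, hπK, hπ⟩ := exists_measurable_projection hK ε
  have hcs : ENNReal.ofReal c ^ (-s) ≠ ∞ := by
    rw [ENNReal.ofReal_rpow_of_pos hc0]; exact ENNReal.ofReal_ne_top
  have hcs0 : ENNReal.ofReal c ^ (-s) ≠ 0 := by
    rw [ENNReal.ofReal_rpow_of_pos hc0]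
    simpa using Real.rpow_pos_of_pos hc0 _
  have key : ∀ ν : ProbabilityMeasure (E d), (ν : Measure (E d)) K'ᶜ = 0 →
      minEnergy s ℓ K ≤ ENNReal.ofReal c ^ (-s) * energy s ℓ ν := by
    intro ν hν
    have hae : ∀ᵐ x ∂(ν : Measure (E d)), x ∈ K' := ae_iff.2 hν
    have hsupp : ((ν.map hπm.aemeasurable : ProbabilityMeasure (E d)) : Measure (E d)) Kᶜ = 0 := by
      rw [ProbabilityMeasure.toMeasure_map]
      rw [Measure.map_apply hπm hKm.compl, Set.preimage_compl,
        Set.preimage_eq_univ_iff.2 (Set.range_subset_iff.2 hπK), Set.compl_univ, measure_empty]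
    have hle : minEnergy s ℓ K ≤ energy s ℓ (ν.map hπm.aemeasurable) := iInf₂_le (ν.map hπm.aemeasurable) hsupp
    refine hle.trans ?_
    have hmeas := measurable_energyKernel (d := d) s ℓ
    have e : energy s ℓ (ν.map hπm.aemeasurable) = ∫⁻ x, ∫⁻ y,
        (max (edist (π x) (π y)) (ENNReal.ofReal ℓ)) ^ (-s) ∂(ν : Measure (E d))
          ∂(ν : Measure (E d)) := by
      rw [energy, ProbabilityMeasure.toMeasure_map]
      rw [lintegral_map hmeas.lintegral_prod_right' hπm]
      refine lintegral_congr fun x => ?_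
      exact lintegral_map (hmeas.comp (measurable_prodMk_left (x := π x))) hπm
    rw [e, energy, ← lintegral_const_mul' _ _ hcs]
    refine lintegral_mono_ae ?_
    filter_upwards [hae] with x hx
    rw [← lintegral_const_mul' _ _ hcs]
    refine lintegral_mono_ae ?_
    filter_upwards [hae] with y hy
    have hx' := hπ x (h x hx)
    have hy' := hπ y (h y hy)
    rw [edist_dist, edist_dist, ← ENNReal.ofReal_max, ← ENNReal.ofReal_max,
      ← ENNReal.mul_rpow_of_ne_top ENNReal.ofReal_ne_top ENNReal.ofReal_ne_top,
      ← ENNReal.ofReal_mul hc0.le]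
    refine rpow_neg_le_rpow_neg hs (ENNReal.ofReal_le_ofReal ?_)
    have h0 : 0 ≤ 2 * ε / ℓ := by positivity
    rw [mul_max_of_nonneg _ _ hc0.le]
    refine max_le ?_ (le_max_of_le_right ?_)
    · rcases le_total (dist x y) ℓ with hle | hle
      · refine le_max_of_le_right ?_
        rw [hc]
        nlinarith [dist_nonneg (x := x) (y := y)]
      · refine le_max_of_le_left ?_
        have h1 := dist_triangle4 x (π x) (π y) y
        rw [dist_comm (π y)] at h1
        have h2 : 2 * ε ≤ 2 * ε / ℓ * dist x y := by
          rw [div_mul_eq_mul_div, le_div_iff₀ hℓ]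
          exact mul_le_mul_of_nonneg_left hle (by linarith)
        rw [hc]
        linarith
    · rw [hc]; nlinarith
  rw [← ENNReal.inv_mul_le_iff hcs0 hcs]
  refine le_iInf₂ fun ν hν => ?_
  rw [ENNReal.inv_mul_le_iff hcs0 hcs]
  exact key ν hν

theorem Curve.exists_dist_lt_of_dist_lt {C C' : Curve Λ} {ε : ℝ} (h : dist C C' < ε) {x : E d}
    (hx : x ∈ C.trace) : ∃ y ∈ C'.trace, dist x y < ε := by
  obtain ⟨f, rfl⟩ := SeparationQuotient.surjective_mk C
  obtain ⟨g, rfl⟩ := SeparationQuotient.surjective_mk C'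
  rw [trace_mk] at hx ⊢
  obtain ⟨t, rfl⟩ := hx
  rw [SeparationQuotient.dist_mk] at h
  obtain ⟨φ, ψ, hφ⟩ := ParamCurve.exists_reparam_lt h
  refine ⟨g.eval (ψ (φ.symm t)), ⟨_, rfl⟩, lt_of_le_of_lt ?_ hφ⟩
  have h1 := ContinuousMap.dist_apply_le_dist (f := f.reparam φ) (g := g.reparam ψ) (φ.symm t)
  have e' : f.reparam φ (φ.symm t) = (show C(I, Λ) from f) t :=
    congrArg (show C(I, Λ) from f) (φ.apply_symm_apply t)
  rw [e'] at h1
  exact h1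

theorem Curve.trace_nonempty (C : Curve Λ) : C.trace.Nonempty := by
  obtain ⟨f, hf⟩ := C.exists_isParam
  rw [trace_eq_of_isParam hf]
  exact Set.range_nonempty _

theorem Curve.isOpen_lt_diam (r : ℝ) : IsOpen {C : Curve Λ | r < C.diam} := by
  rw [Metric.isOpen_iff]
  intro C hC
  obtain ⟨f, hf⟩ := C.exists_isParam
  obtain ⟨a, b, -, -, -, hab⟩ := exists_le_dist_path hf (le_refl C.diam)
  have hmem : ∀ t, f.path t ∈ C.trace := fun t => by
    rw [trace_eq_of_isParam hf]; exact ⟨_, rfl⟩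
  have hC' : r < C.diam := hC
  refine ⟨(C.diam - r) / 2, by linarith, fun C' h => ?_⟩
  rw [Metric.mem_ball, dist_comm] at h
  obtain ⟨x, hx, hx'⟩ := exists_dist_lt_of_dist_lt h (hmem a)
  obtain ⟨y, hy, hy'⟩ := exists_dist_lt_of_dist_lt h (hmem b)
  have h1 : dist x y ≤ C'.diam := Metric.dist_le_diam_of_mem C'.isCompact_trace.isBounded hx hy
  have h2 := dist_triangle4 (f.path a) x y (f.path b)
  rw [dist_comm y] at h2
  change r < C'.diam
  linarith

theorem Curve.isOpen_lt_minEnergy {s ℓ : ℝ} (hs : 0 ≤ s) (hℓ : 0 < ℓ) (u : ℝ≥0) :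
    IsOpen {C : Curve Λ | (u : ℝ≥0∞) < minEnergy s ℓ C.trace} := by
  rw [Metric.isOpen_iff]
  intro C hC
  have hcont : Tendsto (fun ε : ℝ => ENNReal.ofReal ((1 - 2 * ε / ℓ) ^ (-s)) * u) (𝓝[>] 0)
      (𝓝 (ENNReal.ofReal ((1 - 2 * 0 / ℓ) ^ (-s)) * u)) := by
    refine ENNReal.Tendsto.mul_const ?_ (Or.inr ENNReal.coe_ne_top)
    refine (ENNReal.continuous_ofReal.tendsto _).comp ?_
    refine tendsto_nhdsWithin_of_tendsto_nhds ?_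
    refine ContinuousAt.tendsto (f := fun ε : ℝ => (1 - 2 * ε / ℓ) ^ (-s)) ?_
    exact ContinuousAt.rpow_const (by fun_prop) (Or.inl (by simp))
  have hlt : ENNReal.ofReal ((1 - 2 * 0 / ℓ) ^ (-s)) * u < minEnergy s ℓ C.trace := by
    simpa using hC
  obtain ⟨ε, ⟨hε1, hε2⟩, hε0⟩ := (((hcont.eventually_lt_const hlt).and
    (nhdsWithin_le_nhds (eventually_lt_nhds (show (0 : ℝ) < ℓ / 2 by linarith)))).and
      self_mem_nhdsWithin).exists
  have hε0' : 0 < ε := hε0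
  refine ⟨ε, hε0, fun C' h => ?_⟩
  by_contra hnot
  have hle : minEnergy s ℓ C'.trace ≤ u := not_lt.1 hnot
  have h1 := minEnergy_le_of_close hs hℓ hε0'.le (by linarith) C.isCompact_trace.measurableSet
    C.trace_nonempty
    (fun x hx => exists_dist_lt_of_dist_lt (Metric.mem_ball.1 h) hx)
  have hc0 : 0 < 1 - 2 * ε / ℓ := by rw [sub_pos, div_lt_one hℓ]; linarith
  rw [ENNReal.ofReal_rpow_of_pos hc0] at h1
  exact absurd (h1.trans (mul_le_mul_right hle _)) (not_le.2 hε1)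

end MinEnergy

/-! ### Energy and Hausdorff dimension -/

section Dimension

variable {d : ℕ} {Λ : Set (E d)}

/-- Open sets permit a finite subcover, and strictly positive `D n` then permit a cutoff smaller
than all the sizes involved, even if some covering sets are single points. -/
theorem exists_open_cover_of_hausdorffMeasure_eq_zero {s : ℝ} (hs : 0 < s) {K : Set (E d)}
    (h : μH[s] K = 0) {η : ℝ≥0∞} (hη : η ≠ 0) :
    ∃ (U : ℕ → Set (E d)) (D : ℕ → ℝ≥0∞), (∀ n, IsOpen (U n)) ∧ K ⊆ ⋃ n, U n ∧
      (∀ n, 0 < D n) ∧ (∀ n, Metric.ediam (U n) ≤ D n) ∧ ∑' n, D n ^ s ≤ η := by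
  have hη2 : η / 2 ≠ 0 := by simpa using hη
  rw [Measure.hausdorffMeasure_apply] at h
  have h1 := ENNReal.iSup_eq_zero.1 (ENNReal.iSup_eq_zero.1 h 1) one_pos
  have h2 : (⨅ (t : ℕ → Set (E d)) (_ : K ⊆ ⋃ n, t n) (_ : ∀ n, Metric.ediam (t n) ≤ 1),
      ∑' n, ⨆ _ : (t n).Nonempty, Metric.ediam (t n) ^ s) < η / 2 := by
    rw [h1]; exact pos_iff_ne_zero.2 hη2
  simp only [iInf_lt_iff] at h2
  obtain ⟨t, hKt, ht1, hsum⟩ := h2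
  obtain ⟨ε, hε0, hεsum⟩ := ENNReal.exists_pos_sum_of_countable' hη2 ℕ
  have hρ : ∀ n, ∃ ρ : ℝ, 0 < ρ ∧
      (Metric.ediam (t n) + 2 * ENNReal.ofReal ρ) ^ s ≤ Metric.ediam (t n) ^ s + ε n := by
    intro n
    have hfin : Metric.ediam (t n) ^ s ≠ ∞ :=
      ENNReal.rpow_ne_top_of_nonneg hs.le ((ht1 n).trans_lt ENNReal.one_lt_top).ne
    have hcont : Tendsto (fun ρ : ℝ => (Metric.ediam (t n) + 2 * ENNReal.ofReal ρ) ^ s) (𝓝[>] 0)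
        (𝓝 ((Metric.ediam (t n) + 2 * ENNReal.ofReal 0) ^ s)) := by
      refine tendsto_nhdsWithin_of_tendsto_nhds ?_
      refine (ENNReal.continuous_rpow_const.tendsto _).comp ?_
      refine Tendsto.add tendsto_const_nhds ?_
      exact ENNReal.Tendsto.const_mul (ENNReal.continuous_ofReal.tendsto _)
        (Or.inr ENNReal.ofNat_ne_top)
    rw [ENNReal.ofReal_zero, mul_zero, add_zero] at hcont
    obtain ⟨ρ, h1, h2⟩ := ((hcont.eventually_lt_const
      (ENNReal.lt_add_right hfin (hε0 n).ne')).and self_mem_nhdsWithin).exists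
    exact ⟨ρ, h2, h1.le⟩
  choose ρ hρ0 hρs using hρ
  refine ⟨fun n => Metric.thickening (ρ n) (t n),
    fun n => Metric.ediam (t n) + 2 * ENNReal.ofReal (ρ n), fun n => Metric.isOpen_thickening, ?_,
    fun n => ?_, fun n => ?_, ?_⟩
  · exact hKt.trans (Set.iUnion_mono fun n => Metric.self_subset_thickening (hρ0 n) _)
  · refine lt_of_lt_of_le ?_ le_add_self
    have : 0 < ENNReal.ofReal (ρ n) := ENNReal.ofReal_pos.2 (hρ0 n)
    exact ENNReal.mul_pos (by norm_num) this.ne'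
  · have := Metric.ediam_thickening_le (s := t n) (ρ n).toNNReal
    rw [Real.coe_toNNReal _ (hρ0 n).le] at this
    exact this
  · calc ∑' n, (Metric.ediam (t n) + 2 * ENNReal.ofReal (ρ n)) ^ s
        ≤ ∑' n, ((⨆ _ : (t n).Nonempty, Metric.ediam (t n) ^ s) + ε n) := by
          refine ENNReal.tsum_le_tsum fun n => (hρs n).trans (add_le_add ?_ le_rfl)
          rcases (t n).eq_empty_or_nonempty with he | hne
          · rw [he, Metric.ediam_empty, ENNReal.zero_rpow_of_pos hs]; exact zero_le
          · exact le_iSup_of_le hne le_rfl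
      _ ≤ η / 2 + η / 2 := by
          rw [ENNReal.tsum_add]
          exact add_le_add hsum.le hεsum.le
      _ = η := ENNReal.add_halves η

/-- No limit measure is needed. If the `s`-dimensional measure vanished, take a finite open cover
with small `∑ D n ^ s`, a cutoff `ℓ` below every `D n`, and a measure `ν` of energy less than `u +
1` at that cutoff. By Markov, the potential is below `v = 2 (u + 1)` outside mass `1 / 2`. A
covering set that meets this good region has mass at most `v D n ^ s`, so the region has mass at
most `1 / 4`, and the total falls short of one. -/
theorem le_dimH_of_minEnergy_le {s : ℝ} (hs : 0 < s) {K : Set (E d)} (hK : IsCompact K) (u : ℝ≥0)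
    (h : ∀ ℓ : ℝ, 0 < ℓ → minEnergy s ℓ K ≤ u) : ENNReal.ofReal s ≤ dimH K := by
  by_contra hlt
  have hzero : μH[s] K = 0 := by
    have := hausdorffMeasure_of_dimH_lt (X := E d) (s := K) (d := s.toNNReal) (not_le.1 hlt)
    rwa [Real.coe_toNNReal _ hs.le] at this
  set v : ℝ≥0∞ := 2 * (u + 1) with hv
  have hv0 : v ≠ 0 := by simp [hv]
  have hvt : v ≠ ∞ := by simp [hv, ENNReal.mul_eq_top]
  obtain ⟨U, D, hUo, hKU, hD0, hUD, hsum⟩ := exists_open_cover_of_hausdorffMeasure_eq_zero hs hzero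
    (η := (4 * v)⁻¹) (by simp [ENNReal.mul_eq_top, hvt])
  have hDt : ∀ n, D n ≠ ∞ := fun n hn => by
    have h1 := (ENNReal.le_tsum n).trans hsum
    rw [hn, ENNReal.top_rpow_of_pos hs] at h1
    have : (4 * v)⁻¹ ≠ ∞ := by simp [hv0]
    exact this (top_le_iff.1 h1)
  obtain ⟨J, hJ⟩ := hK.elim_finite_subcover U hUo hKU
  obtain ⟨ℓ, hℓ0, hℓ⟩ : ∃ ℓ : ℝ, 0 < ℓ ∧ ∀ n ∈ J, ENNReal.ofReal ℓ ≤ D n := by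
    have hev : ∀ᶠ ℓ : ℝ in 𝓝[>] 0, ∀ n ∈ J, ENNReal.ofReal ℓ ≤ D n := by
      rw [Filter.eventually_all_finset]
      intro n _
      have : Tendsto ENNReal.ofReal (𝓝[>] 0) (𝓝 0) := by
        have := (ENNReal.continuous_ofReal.tendsto 0)
        rw [ENNReal.ofReal_zero] at this
        exact tendsto_nhdsWithin_of_tendsto_nhds this
      filter_upwards [this.eventually_lt_const (hD0 n)] with x hx using hx.le
    obtain ⟨ℓ, h1, h2⟩ := (hev.and self_mem_nhdsWithin).exists
    exact ⟨ℓ, h2, h1⟩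
  have hlt' : minEnergy s ℓ K < u + 1 :=
    (h ℓ hℓ0).trans_lt (ENNReal.lt_add_right ENNReal.coe_ne_top one_ne_zero)
  simp only [minEnergy, iInf_lt_iff] at hlt'
  obtain ⟨ν, hνK, hE⟩ := hlt'
  set k : E d → E d → ℝ≥0∞ := fun x y => (max (edist x y) (ENNReal.ofReal ℓ)) ^ (-s) with hk
  set pot : E d → ℝ≥0∞ := fun x => ∫⁻ y, k x y ∂(ν : Measure (E d)) with hpot
  have hpm : Measurable pot := (measurable_energyKernel (d := d) s ℓ).lintegral_prod_right'
  have hmarkov : v * (ν : Measure (E d)) {x | v ≤ pot x} ≤ u + 1 :=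
    (mul_meas_ge_le_lintegral hpm v).trans hE.le
  have hbad : (ν : Measure (E d)) {x | v ≤ pot x} ≤ 2⁻¹ := by
    have h0 : (u : ℝ≥0∞) + 1 ≠ 0 := by simp
    have ht : (u : ℝ≥0∞) + 1 ≠ ∞ := by simp
    rw [hv, mul_assoc, mul_left_comm] at hmarkov
    have h3 : 2 * (ν : Measure (E d)) {x | v ≤ pot x} ≤ 1 := by
      refine (ENNReal.mul_le_mul_iff_right h0 ht).1 ?_
      rwa [mul_one]
    rw [← one_div, ENNReal.le_div_iff_mul_le (by simp) (by simp), mul_comm]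
    exact h3
  have hgood : (ν : Measure (E d)) (K ∩ {x | pot x < v}) ≤ 4⁻¹ := by
    calc (ν : Measure (E d)) (K ∩ {x | pot x < v})
        ≤ (ν : Measure (E d)) (⋃ n ∈ J, U n ∩ {x | pot x < v}) := by
          refine measure_mono fun x hx => ?_
          obtain ⟨n, hn, hxn⟩ := Set.mem_iUnion₂.1 (hJ hx.1)
          exact Set.mem_iUnion₂.2 ⟨n, hn, hxn, hx.2⟩
      _ ≤ ∑ n ∈ J, (ν : Measure (E d)) (U n ∩ {x | pot x < v}) :=
          measure_biUnion_finset_le _ _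
      _ ≤ ∑ n ∈ J, v * D n ^ s := by
          refine Finset.sum_le_sum fun n hn => ?_
          rcases (U n ∩ {x | pot x < v}).eq_empty_or_nonempty with he | ⟨x, hxU, hxv⟩
          · rw [he, measure_empty]; exact zero_le
          · have hDs0 : D n ^ s ≠ 0 := (ENNReal.rpow_pos (hD0 n) (hDt n)).ne'
            have hDst : D n ^ s ≠ ∞ := ENNReal.rpow_ne_top_of_nonneg hs.le (hDt n)
            have h1 : (D n ^ s)⁻¹ * (ν : Measure (E d)) (U n) ≤ pot x := by
              rw [← ENNReal.rpow_neg, ← setLIntegral_const]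
              refine le_trans (setLIntegral_mono' (hUo n).measurableSet fun y hy => ?_)
                (setLIntegral_le_lintegral (U n) _)
              exact rpow_neg_le_rpow_neg hs.le
                (max_le ((Metric.edist_le_ediam_of_mem hxU hy).trans (hUD n)) (hℓ n hn))
            have h2 : (D n ^ s)⁻¹ * (ν : Measure (E d)) (U n) ≤ v := h1.trans (le_of_lt hxv)
            rw [ENNReal.inv_mul_le_iff hDs0 hDst, mul_comm] at h2
            exact (measure_mono Set.inter_subset_left).trans h2
      _ ≤ v * (4 * v)⁻¹ := by
          rw [← Finset.mul_sum]
          gcongr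
          exact (ENNReal.sum_le_tsum J).trans hsum
      _ = 4⁻¹ := by
          rw [ENNReal.mul_inv (Or.inr hvt) (Or.inr hv0), mul_left_comm,
            ENNReal.mul_inv_cancel hv0 hvt, mul_one]
  have hone : (1 : ℝ≥0∞) ≤ 4⁻¹ + 2⁻¹ := by
    calc (1 : ℝ≥0∞) = (ν : Measure (E d)) Set.univ := measure_univ.symm
      _ ≤ (ν : Measure (E d)) (K ∩ {x | pot x < v} ∪ {x | v ≤ pot x} ∪ Kᶜ) := by
          refine measure_mono fun x _ => ?_
          by_cases hxK : x ∈ K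
          · rcases lt_or_ge (pot x) v with h' | h'
            · exact Or.inl (Or.inl ⟨hxK, h'⟩)
            · exact Or.inl (Or.inr h')
          · exact Or.inr hxK
      _ ≤ 4⁻¹ + 2⁻¹ + 0 :=
          (measure_union_le _ _).trans (add_le_add ((measure_union_le _ _).trans
            (add_le_add hgood hbad)) hνK.le)
      _ = 4⁻¹ + 2⁻¹ := add_zero _
  have hnum : (4⁻¹ + 2⁻¹ : ℝ≥0∞) < 1 := by
    have e : (4⁻¹ + 2⁻¹ : ℝ≥0∞) = ENNReal.ofReal (4⁻¹ + 2⁻¹) := by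
      rw [ENNReal.ofReal_add (by norm_num) (by norm_num), ENNReal.ofReal_inv_of_pos (by norm_num),
        ENNReal.ofReal_inv_of_pos (by norm_num)]
      simp
    rw [e, ← ENNReal.ofReal_one]
    exact (ENNReal.ofReal_lt_ofReal_iff one_pos).2 (by norm_num)
  exact absurd hone (not_le.2 hnum)

/-- Arc length parametrization: `f` factors through its variation function `v` by a map that is
`1`-Lipschitz on the range of `v`, a subset of the line. -/
theorem dimH_range_le_one_of_eVariationOn_ne_top {X : Type*} [MetricSpace X] {f : I → X}
    (hf : eVariationOn f Set.univ ≠ ∞) : dimH (Set.range f) ≤ 1 := by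
  have hbv : BoundedVariationOn f Set.univ := hf
  have hloc := hbv.locallyBoundedVariationOn
  set v : I → ℝ := fun t => variationOnFromTo f Set.univ 0 t with hv
  have hdist : ∀ a b, dist (f a) (f b) ≤ dist (v a) (v b) := by
    have key : ∀ a b, a ≤ b → dist (f a) (f b) ≤ dist (v a) (v b) := by
      intro a b hab
      have h1 := variationOnFromTo.sub_right hloc (Set.mem_univ (0 : I)) (Set.mem_univ b)
        (Set.mem_univ a)
      have h2 : dist (f a) (f b) ≤ variationOnFromTo f Set.univ a b := by
        rw [variationOnFromTo.eq_of_le f _ hab]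
        exact (hbv.mono Set.inter_subset_left).dist_le ⟨trivial, le_rfl, hab⟩ ⟨trivial, hab, le_rfl⟩
      rw [dist_comm (v a), Real.dist_eq]
      exact h2.trans (h1.symm.le.trans (le_abs_self _))
    intro a b
    rcases le_total a b with h | h
    · exact key a b h
    · rw [dist_comm (f a), dist_comm (v a)]; exact key b a h
  set g : ℝ → X := f ∘ Function.invFun v with hg
  have hginv : ∀ t, v (Function.invFun v (v t)) = v t := fun t =>
    Function.invFun_eq ⟨t, rfl⟩
  have hgv : ∀ t, g (v t) = f t := fun t => by
    refine dist_le_zero.1 ((hdist _ _).trans ?_)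
    rw [hginv, dist_self]
  have hlip : LipschitzOnWith 1 g (Set.range v) := by
    refine LipschitzOnWith.of_dist_le_mul ?_
    rintro _ ⟨a, rfl⟩ _ ⟨b, rfl⟩
    rw [hgv, hgv, NNReal.coe_one, one_mul]
    exact hdist a b
  have himg : Set.range f = g '' Set.range v := by
    rw [← Set.range_comp]
    exact congrArg Set.range (funext fun t => (hgv t).symm)
  rw [himg]
  exact hlip.dimH_image_le.trans ((dimH_mono (Set.subset_univ _)).trans Real.dimH_univ.le)

theorem Curve.dimH_trace_le_one_of_isRectifiable {C : Curve Λ} (h : C.IsRectifiable) :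
    dimH C.trace ≤ 1 := by
  obtain ⟨f, hf, hvar⟩ := h
  rw [trace_eq_of_isParam hf]
  exact dimH_range_le_one_of_eVariationOn_ne_top hvar

end Dimension

/-! ### Scaling limits -/

section Limit

variable {d : ℕ} {Λ : Set (E d)}

theorem isOpen_exists_mem {U : Set (Curve Λ)} (hU : IsOpen U) :
    IsOpen {F : Config Λ | ∃ C ∈ F, C ∈ U} :=
  Closeds.isOpen_inter_nonempty_of_isOpen hU

/-- Some curve of diameter larger than `r` has minimal energy at cutoff `ℓ` larger than `u`. -/
def lowCapacityEvent (Λ : Set (E d)) (s r ℓ : ℝ) (u : ℝ≥0) : Set (Config Λ) :=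
  {F | ∃ C ∈ F, r < C.diam ∧ (u : ℝ≥0∞) < minEnergy s ℓ C.trace}

theorem isOpen_lowCapacityEvent {s ℓ : ℝ} (hs : 0 ≤ s) (hℓ : 0 < ℓ) (r : ℝ) (u : ℝ≥0) :
    IsOpen (lowCapacityEvent Λ s r ℓ u) :=
  isOpen_exists_mem ((Curve.isOpen_lt_diam r).inter (Curve.isOpen_lt_minEnergy hs hℓ u))

theorem lowCapacityEvent_subset {s r ℓ δ : ℝ} (hs : 0 ≤ s) (hδ : δ ≤ ℓ) (u : ℝ≥0) :
    lowCapacityEvent Λ s r ℓ u ⊆ {F | (u : ℝ≥0∞) ≤ (minCapacity s r δ F)⁻¹} := by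
  rintro F ⟨C, hC, hr, hu⟩
  have h1 : minCapacity s r δ F ≤ capacity s δ C.trace :=
    iInf_le_of_le C (iInf_le_of_le hC (iInf_le_of_le hr.le le_rfl))
  have h2 := ENNReal.inv_le_inv.2 h1
  rw [inv_capacity] at h2
  exact (hu.le.trans (minEnergy_anti hs hδ _)).trans h2

/-- For a fixed cutoff `ℓ` the bad event is open, and for `δ n ≤ ℓ` it is contained in the event
controlled at `δ n`, because lowering the cutoff raises the energy. The portmanteau inequality gives
a bound `ε` for each `ℓ` with the same `u`. The events increase as `ℓ` decreases, so their union
obeys the same bound. -/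
theorem ae_exists_minEnergy_le {δmax : ℝ} {μ : Set.Ioc 0 δmax → ProbabilityMeasure (Config Λ)}
    {s r : ℝ} (hs : 0 ≤ s)
    (h : StochasticallyBoundedAwayFromZero μ (fun δ F => minCapacity s r (δ : ℝ) F))
    {δ : ℕ → Set.Ioc 0 δmax} {ν : ProbabilityMeasure (Config Λ)}
    (hδ : Tendsto (fun n => (δ n : ℝ)) atTop (𝓝 0))
    (hν : Tendsto (fun n => μ (δ n)) atTop (𝓝 ν)) :
    ∀ᵐ F ∂(ν : Measure (Config Λ)), ∀ C ∈ F, r < C.diam →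
      ∃ u : ℝ≥0, ∀ ℓ : ℝ, 0 < ℓ → minEnergy s ℓ C.trace ≤ u := by
  rw [ae_iff]
  refine le_antisymm (ENNReal.le_of_forall_pos_le_add fun ε hε _ => ?_) zero_le
  rw [zero_add]
  obtain ⟨u, hu⟩ := h ε hε
  have hj0 : ∀ j : ℕ, (0 : ℝ) < 1 / ((j : ℝ) + 1) := fun j => Nat.one_div_pos_of_nat
  have hmono : Monotone fun j : ℕ => lowCapacityEvent Λ s r (1 / ((j : ℝ) + 1)) u := by
    rintro i j hij F ⟨C, hC, hr, hu⟩
    exact ⟨C, hC, hr, hu.trans_le (minEnergy_anti hs (Nat.one_div_le_one_div hij) _)⟩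
  have hbound : ∀ j : ℕ,
      (ν : Measure (Config Λ)) (lowCapacityEvent Λ s r (1 / ((j : ℝ) + 1)) u) ≤ ε := by
    intro j
    refine (ProbabilityMeasure.le_liminf_measure_open_of_tendsto hν
      (isOpen_lowCapacityEvent hs (hj0 j) r u)).trans ?_
    refine Filter.liminf_le_of_frequently_le' (Eventually.frequently ?_)
    filter_upwards [hδ.eventually_lt_const (hj0 j)] with n hn
    have h1 := hu (δ n)
    rw [measureReal_def] at h1
    have h2 : (μ (δ n) : Measure (Config Λ)) {F | (u : ℝ≥0∞) ≤ (minCapacity s r (δ n : ℝ) F)⁻¹}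
        ≤ ENNReal.ofReal ε := (ENNReal.le_ofReal_iff_toReal_le (measure_ne_top _ _) ε.2).2 h1
    rw [ENNReal.ofReal_coe_nnreal] at h2
    exact (measure_mono (lowCapacityEvent_subset hs hn.le u)).trans h2
  calc (ν : Measure (Config Λ)) _
      ≤ (ν : Measure (Config Λ)) (⋃ j : ℕ, lowCapacityEvent Λ s r (1 / ((j : ℝ) + 1)) u) := by
        refine measure_mono fun F hF => ?_
        simp only [Set.mem_ofPred_eq, not_forall, not_exists, not_le] at hF
        obtain ⟨C, hC, hr, hall⟩ := hF
        obtain ⟨ℓ, hℓ, hlt⟩ := hall u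
        obtain ⟨j, hj⟩ := exists_nat_one_div_lt hℓ
        exact Set.mem_iUnion.2 ⟨j, C, hC, hr, hlt.trans_le (minEnergy_anti hs hj.le _)⟩
    _ = ⨆ j : ℕ, (ν : Measure (Config Λ)) (lowCapacityEvent Λ s r (1 / ((j : ℝ) + 1)) u) :=
        hmono.measure_iUnion
    _ ≤ ε := iSup_le hbound

theorem ae_le_dimH_of_stochasticallyBoundedAwayFromZero {δmax D : ℝ}
    {μ : Set.Ioc 0 δmax → ProbabilityMeasure (Config Λ)}
    (h : ∀ r s : ℝ, 0 < r → 0 < s → s < D →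
      StochasticallyBoundedAwayFromZero μ (fun δ F => minCapacity s r (δ : ℝ) F))
    {δ : ℕ → Set.Ioc 0 δmax} {ν : ProbabilityMeasure (Config Λ)}
    (hδ : Tendsto (fun n => (δ n : ℝ)) atTop (𝓝 0))
    (hν : Tendsto (fun n => μ (δ n)) atTop (𝓝 ν)) :
    ∀ᵐ F ∂(ν : Measure (Config Λ)), ∀ C ∈ F, 0 < C.diam → ENNReal.ofReal D ≤ dimH C.trace := by
  have hall : ∀ᵐ F ∂(ν : Measure (Config Λ)), ∀ (j : ℕ) (s : ℚ), 0 < (s : ℝ) → (s : ℝ) < D →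
      ∀ C ∈ F, 1 / ((j : ℝ) + 1) < C.diam →
        ∃ u : ℝ≥0, ∀ ℓ : ℝ, 0 < ℓ → minEnergy s ℓ C.trace ≤ u := by
    refine ae_all_iff.2 fun j => ae_all_iff.2 fun s => ?_
    by_cases hs : 0 < (s : ℝ) ∧ (s : ℝ) < D
    · filter_upwards [ae_exists_minEnergy_le hs.1.le
        (h (1 / ((j : ℝ) + 1)) s Nat.one_div_pos_of_nat hs.1 hs.2) hδ hν] with F hF _ _
      exact hF
    · exact ae_of_all _ fun F h1 h2 => absurd ⟨h1, h2⟩ hs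
  filter_upwards [hall] with F hF C hC hdiam
  obtain ⟨j, hj⟩ := exists_nat_one_div_lt hdiam
  by_contra hlt
  rw [not_le] at hlt
  have hfin : dimH C.trace ≠ ∞ := hlt.ne_top
  have h1 : (dimH C.trace).toReal < D := by
    rwa [ENNReal.lt_ofReal_iff_toReal_lt hfin] at hlt
  obtain ⟨s, hs1, hs2⟩ := exists_rat_btwn h1
  have hs0 : 0 < (s : ℝ) := ENNReal.toReal_nonneg.trans_lt hs1
  obtain ⟨u, hu⟩ := hF j s hs0 hs2 C hC hj
  have h2 := le_dimH_of_minEnergy_le hs0 C.isCompact_trace u hu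
  rw [ENNReal.ofReal_le_iff_le_toReal hfin] at h2
  exact absurd h2 (not_le.2 hs1)

end Limit

end

end RandomCurves

theorem mainTheorem3 {d : ℕ} (Λ : Set (E d)) (hΛ : IsCompact Λ) (δmax : ℝ)
    (μ : Set.Ioc 0 δmax → ProbabilityMeasure (Config Λ)) (hμ : HypothesisH2 μ) :
    ∃ dmin : ℝ, 1 < dmin ∧
      (∀ r s : ℝ, 0 < r → 0 < s → s < dmin →
        StochasticallyBoundedAwayFromZero μ (fun δ F => minCapacity s r (δ : ℝ) F)) ∧
      (∀ (δ : ℕ → Set.Ioc 0 δmax) (ν : ProbabilityMeasure (Config Λ)),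
        Tendsto (fun n => (δ n : ℝ)) atTop (𝓝 0) →
        Tendsto (fun n => μ (δ n)) atTop (𝓝 ν) →
        ∀ᵐ F ∂(ν : Measure (Config Λ)), ∀ C ∈ F, 0 < C.diam →
          ENNReal.ofReal dmin ≤ dimH C.trace ∧ ¬ C.IsRectifiable) := by
  obtain ⟨σ, ρ, K, hσ, hρ0, hρ1, H⟩ := hμ
  obtain ⟨q, p, hq, hσq, hP, hpow⟩ := exists_parameters d hσ hρ0 hρ1
  have hcap : ∀ r s : ℝ, 0 < r → 0 < s → s < roughDim q →
      StochasticallyBoundedAwayFromZero μ (fun δ F => minCapacity s r (δ : ℝ) F) :=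
    fun r s hr hs hsd => stochasticallyBoundedAwayFromZero_minCapacity hΛ hσ hρ0 hρ1 H hq hσq hP
      hpow hr hs hsd
  refine ⟨roughDim q, one_lt_roughDim hq, hcap, fun δ ν hδ hν => ?_⟩
  filter_upwards [ae_le_dimH_of_stochasticallyBoundedAwayFromZero hcap hδ hν] with F hF C hC hdiam
  refine ⟨hF C hC hdiam, fun hrect => ?_⟩
  have h1 := (hF C hC hdiam).trans (Curve.dimH_trace_le_one_of_isRectifiable hrect)
  rw [← ENNReal.ofReal_one, ENNReal.ofReal_le_ofReal_iff zero_le_one] at h1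
  exact absurd h1 (not_le.2 (one_lt_roughDim hq))
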